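/- Correlation clustering: given a finite simple graph $G=(V,E)$ on $n=|V|$ vertices, the cost of a partition of $V$ into clusters is the number of edges between different clusters plus the number of non-adjacent pairs of distinct vertices inside the same cluster; let $\mathrm{opt}(G)$ be the minimum cost. LOCAL model: the communication network is $G$ itself. Each vertex $v$ hosts a computationally unbounded processor that initially knows $n$, its degree, its own unique identifier $\mathrm{id}(v)\in\{0,\dots,n^k-1\}$ (where $k$ is a fixed constant) and a private seed; seeds of different vertices are independent and uniform. Each vertex numbers its neighbors arbitrarily. In each synchronous round every vertex sends a bit string to each neighbor and receives the bit strings of its neighbors. At the end each vertex outputs a label, and vertices with equal labels form a cluster. Algorithm $r$-Pivot for a priority order $\pi$ on $V$: initially all vertices are unsettled. In each of $r$ rounds, mark every unsettled vertex that precedes all its unsettled neighbors in $\pi$ as a pivot, and then mark all pivots and their neighbors as settled. Afterwards every pivot starts a cluster containing itself. A non-pivot $u$ forms a singleton cluster if $N(u)$ contains no pivot, or if some unsettled vertex in $N(u)$ precedes all pivots in $N(u)$; otherwise $u$ joins the cluster of the first pivot in $N(u)$. Statement: For every $k$ there is a constant $C$ such that for every $\epsilon>0$ there are integers $r\ge 1$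 and $c\ge 0$, with $r\le C\lceil 1/\epsilon\rceil$, and a randomized LOCAL algorithm with the following properties. On every graph $G$ with $n$ vertices, for every assignment of distinct identifiers from $\{0,\dots,n^k-1\}$ and every port numbering, (1) the algorithm runs for at most $C\lceil 1/\epsilon\rceil$ rounds; (2) in every execution each message has at most $C\log_2 n$ bits; (3) the seed of each vertex is a rank drawn independently and uniformly from $\{0,\dots,n^c-1\}$, and the output is always the clustering produced by $r$-Pivot when vertices are ordered by rank, ties being broken in favor of the smaller identifier; (4) the expected cost of the output is at most $(3+\epsilon)\,\mathrm{opt}(G)$. -/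

import Mathlib

/-! ### Correlation clustering

The input is a finite graph `G`: an edge means that its endpoints are similar, a non-edge that they
are dissimilar. A clustering is a partition of the vertex set, that is, a `Setoid`. -/

/-- The graph of the pairs of distinct vertices on which the clustering `s` disagrees with `G`:
edges across clusters and non-edges inside a cluster. -/
def disagreement {V : Type*} (G : SimpleGraph V) (s : Setoid V) : SimpleGraph V where
  Adj u v := u ≠ v ∧ ¬ (G.Adj u v ↔ s u v)
  symm := ⟨fun _ _ h => ⟨h.1.symm, fun h' => h.2
    ⟨fun a => s.symm' (h'.1 a.symm), fun a => (h'.2 (s.symm' a)).symm⟩⟩⟩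
  loopless := ⟨fun _ h => h.1 rfl⟩

/-- Cost of a clustering: the number of unordered pairs on which it disagrees with `G`. -/
noncomputable def clusteringCost {V : Type*} (G : SimpleGraph V) (s : Setoid V) : ℕ :=
  (disagreement G s).edgeSet.ncard

/-- The optimal cost; the infimum of a nonempty set of natural numbers, hence a minimum. -/
noncomputable def optCost {V : Type*} (G : SimpleGraph V) : ℕ :=
  ⨅ s : Setoid V, clusteringCost G s

/-! ### The algorithm `r`-Pivot, for a given priority function `π` (lower is better) -/

/-- The settled vertices when `P` is the set of the pivots marked so far. -/
def settledBy {V : Type*} (G : SimpleGraph V) (P : Set V) : Set V :=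
  {v | v ∈ P ∨ ∃ p ∈ P, G.Adj p v}

/-- The pivots after a number of rounds: in each round, every unsettled vertex that precedes all
its unsettled neighbours becomes a pivot. -/
def rPivots {V α : Type*} [LinearOrder α] (G : SimpleGraph V) (π : V → α) : ℕ → Set V
  | 0 => ∅
  | r + 1 => rPivots G π r ∪
      {v | v ∉ settledBy G (rPivots G π r) ∧
        ∀ u, G.Adj v u → u ∉ settledBy G (rPivots G π r) → π v < π u}

/-- After `r` rounds the non-pivot `u` joins the pivot `p`: `p` is the first pivot in `N(u)`, and
no unsettled vertex of `N(u)` precedes all the pivots in `N(u)`. -/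
def JoinsPivot {V α : Type*} [LinearOrder α] (G : SimpleGraph V) (π : V → α) (r : ℕ)
    (u p : V) : Prop :=
  u ∉ rPivots G π r ∧
  (p ∈ rPivots G π r ∧ G.Adj u p ∧ ∀ q ∈ rPivots G π r, G.Adj u q → π p ≤ π q) ∧
  ¬ ∃ w, G.Adj u w ∧ w ∉ settledBy G (rPivots G π r) ∧
    ∀ q ∈ rPivots G π r, G.Adj u q → π w < π q

open Classical in
/-- The vertex whose cluster `u` belongs to: the pivot it joins, or `u` itself if `u` is a pivot or
forms a singleton cluster. -/
noncomputable def rPivotCenter {V α : Type*} [LinearOrder α] (G : SimpleGraph V) (π : V → α)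
    (r : ℕ) (u : V) : V :=
  if h : ∃ p, JoinsPivot G π r u p then h.choose else u

/-- The clustering output by `r`-Pivot. -/
noncomputable def rPivotClustering {V α : Type*} [LinearOrder α] (G : SimpleGraph V) (π : V → α)
    (r : ℕ) : Setoid V :=
  Setoid.ker (rPivotCenter G π r)

/-! ### The LOCAL model -/

/-- A port numbering: every vertex numbers its neighbours, arbitrarily. -/
abbrev PortNumbering {V : Type*} [Fintype V] (G : SimpleGraph V) [DecidableRel G.Adj] : Type _ :=
  ∀ v, Fin (G.degree v) ≃ G.neighborSet v

/-- A randomized synchronous message-passing algorithm with computationally unbounded processors.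
A processor starts with the number `n` of vertices, its own identifier and degree, and a private
seed. In every round it sends a bit string through each of its ports, and updates its state from
the list of the bit strings that it receives, in the order of its ports. After `rounds n` rounds it
outputs a cluster label. -/
structure LocalAlgorithm where
  /-- The seeds are drawn uniformly from `{0, …, numSeeds n - 1}`. -/
  numSeeds : ℕ → ℕ
  numSeeds_pos : ∀ n, 0 < numSeeds n
  rounds : ℕ → ℕ
  State : Type
  init : (n ident deg : ℕ) → (seed : Fin (numSeeds n)) → State
  send : State → (port : ℕ) → List Bool
  receive : State → (messages : List (List Bool)) → State
  output : State → ℕ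

namespace LocalAlgorithm

variable {V : Type*} [Fintype V] (A : LocalAlgorithm) (G : SimpleGraph V) [DecidableRel G.Adj]
  (ident : V → ℕ) (port : PortNumbering G)

/-- An assignment of a seed to every vertex. -/
abbrev Seeds (V : Type*) [Fintype V] (A : LocalAlgorithm) : Type _ :=
  V → Fin (A.numSeeds (Fintype.card V))

/-- The message that arrives at port `i` of `v` when the states are `σ`. -/
def incoming (σ : V → A.State) (v : V) (i : Fin (G.degree v)) : List Bool :=
  A.send (σ (port v i)) ((port (port v i)).symm ⟨v, (port v i).2.symm⟩)

/-- The states after `t` rounds. -/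
def stateAt (ω : A.Seeds V) : ℕ → V → A.State
  | 0, v => A.init (Fintype.card V) (ident v) (G.degree v) (ω v)
  | t + 1, v => A.receive (stateAt ω t v)
      (List.ofFn fun i => A.incoming G port (stateAt ω t) v i)

/-- The clustering that is output: vertices with equal labels form a cluster. -/
def clustering (ω : A.Seeds V) : Setoid V :=
  Setoid.ker fun v => A.output (A.stateAt G ident port ω (A.rounds (Fintype.card V)) v)

/-- In every execution, all messages have at most `B` bits. -/
def MessagesBounded (B : ℝ) : Prop :=
  ∀ (ω : A.Seeds V) (t : ℕ), t < A.rounds (Fintype.card V) →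
    ∀ (v : V) (i : Fin (G.degree v)),
      ((A.incoming G port (A.stateAt G ident port ω t) v i).length : ℝ) ≤ B

/-- The expected cost of the output over independent uniform seeds. -/
noncomputable def expectedCost [DecidableEq V] : ℝ :=
  (∑ ω : A.Seeds V, (clusteringCost G (A.clustering G ident port ω) : ℝ)) /
    Fintype.card (A.Seeds V)

end LocalAlgorithm

/-!
`r`-Pivot is sequential Pivot cut off after `r` rounds. Sequential Pivot lists the vertices in the
priority order; a listed vertex that is still alive becomes a pivot, and it dies together with its
alive neighbours, which form its cluster.

*Sequential Pivot is a 3-approximation.* When the next vertex is uniformly random, the ordered pairs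
on which the new cluster errs are, in total over the choices of that vertex, the bad triangles
(exactly two edges) among the alive vertices. Every clustering disagrees with `G` on some pair of
each bad triangle, and the third vertex of the triangle, when listed, kills that pair
(`PivotState.sum_pivotErrors_le`).

*Cutting off costs little.* Every vertex `x` carries a load, which counts the decreasing chains
`x > u₀ > p₁ > u₁ > p₂ > …` of adjacent vertices in which `pᵢ₊₁` is the first pivot next to `uᵢ`.
A pivot that is not found in `r` rounds has load at least `r` (`IsGreedyPivot.le_load`), so an edge inside a
cluster of sequential Pivot is cut by `r`-Pivot only if one of its ends or the pivot has load at
least `r` (`rPivotCenter_eq_of_mem_cluster`). The heart of the proof is that the expected total load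
of the dying vertices, weighted by alive degrees, is at most the expected number of edges cut by
sequential Pivot. This is a potential argument (`PivotState.sum_potential_step_le`): the potential
is the total load of the alive vertices, weighted by alive degrees, plus the load that they will
still receive. On an induced path `z - u - x` the load of `z` is passed on across the edge `ux` if
`z` is listed, and if `x` is listed the edge `zu`, with the load of `z` on it, is destroyed; as `z`
and `x` are equally likely to be the next vertex, these two effects cancel. Hence `r`-Pivot on a
uniformly random order costs at most `(3 + 9 / r) opt` in expectation
(`mul_sum_pivotErrorBound_le_optCost`).

*Seeds.* Ranks from `{0, …, n ^ c - 1}` without ties induce a uniformly random order. Ties have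
probability at most `n ^ (2 - c)` and cost at most `n ^ 2`, which is negligible against
`opt ≥ 1`; if `opt = 0`, then `r`-Pivot with `r ≥ 1` makes no error for any order (`sum_cost_le`).

*Messages.* The vertices compare integer keys below `n ^ (c + k)`, which encode rank and identifier.
As `c` depends on `ε`, a key is too long for one message; it is sent digit by digit in base `n`
during `c + k` rounds, after which two rounds with one-bit messages simulate one round of `r`-Pivot
(`update_pivotNodeState`).
-/

open Finset

/-! ### One step of sequential Pivot and the potential -/

/-- A state of sequential Pivot, enriched by the bookkeeping of the potential argument. -/
structure PivotState (V : Type*) where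
  /-- The vertices that have not been listed yet. -/
  remaining : Finset V
  /-- The vertices that are neither pivots nor adjacent to a pivot. -/
  alive : Finset V
  /-- For a dead non-pivot, one more than the load of the pivot that killed it; meaningless for
  other vertices. -/
  mark : V → ℕ
  /-- The sum of the marks of the neighbours that were dead already when they were listed. -/
  load : V → ℕ

namespace PivotState

variable {V : Type*} [DecidableEq V] (G : SimpleGraph V) [DecidableRel G.Adj]

/-- The vertices that die when the alive vertex `z` is listed. -/
def cluster (s : PivotState V) (z : V) : Finset V :=
  {x ∈ s.alive | x = z ∨ G.Adj z x}

/-- The state after listing `z`. -/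
def step (s : PivotState V) (z : V) : PivotState V :=
  if z ∈ s.alive then
    { remaining := s.remaining.erase z
      alive := s.alive \ s.cluster G z
      mark := fun u => if u ∈ s.cluster G z then 1 + s.load z else s.mark u
      load := s.load }
  else
    { remaining := s.remaining.erase z
      alive := s.alive
      mark := s.mark
      load := fun x => s.load x + if G.Adj z x then s.mark z else 0 }

/-- The number of alive neighbours. -/
def aliveDegree (s : PivotState V) (x : V) : ℕ := #{u ∈ s.alive | G.Adj x u}

/-- The load that `x` receives in the future from neighbours that are dead now. -/
def pendingMark (s : PivotState V) (x : V) : ℕ :=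
  ∑ u ∈ s.remaining \ s.alive with G.Adj x u, s.mark u

/-- The load of the alive vertices, weighted by alive degrees, plus the load that they will still
receive from dead vertices. The second part needs no weight: if `x` has alive degree `d`, then it
survives until a given dead neighbour is listed with probability at most `1 / (d + 2)`, since
`d + 1` alive vertices would kill it. -/
def potential (s : PivotState V) : ℕ :=
  ∑ x ∈ s.alive, s.pendingMark G x + ∑ x ∈ s.alive, s.load x * s.aliveDegree G x

/-- The number of edges that are cut when `z` is listed: those between the new cluster and the
surviving vertices. -/
def cutEdges (s : PivotState V) (z : V) : ℕ :=
  if z ∈ s.alive then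
    ∑ x ∈ s.alive \ s.cluster G z, #{u ∈ s.cluster G z | G.Adj x u} else 0

/-- The loads of the vertices that die when `z` is listed, each counted once for every alive edge at
the vertex. -/
def killedLoad (s : PivotState V) (z : V) : ℕ :=
  if z ∈ s.alive then ∑ x ∈ s.cluster G z, s.load x * s.aliveDegree G x else 0

variable {G} {s : PivotState V} {z x y : V}

theorem mem_cluster : x ∈ s.cluster G z ↔ x ∈ s.alive ∧ (x = z ∨ G.Adj z x) := by
  simp [cluster]

theorem cluster_subset : s.cluster G z ⊆ s.alive := filter_subset _ _

theorem mem_cluster_comm (hx : x ∈ s.alive) (hz : z ∈ s.alive) :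
    x ∈ s.cluster G z ↔ z ∈ s.cluster G x := by
  simp [mem_cluster, hx, hz, eq_comm, G.adj_comm]

theorem card_cluster (hz : z ∈ s.alive) : #(s.cluster G z) = s.aliveDegree G z + 1 := by
  have : s.cluster G z = insert z {u ∈ s.alive | G.Adj z u} := by
    ext x; simp only [mem_cluster, mem_insert, mem_filter]
    constructor
    · rintro ⟨h, h' | h'⟩ <;> tauto
    · rintro (rfl | h) <;> tauto
  rw [this, card_insert_of_notMem (by simp), aliveDegree]

theorem sum_sum_cluster (f : V → ℕ) :
    ∑ z ∈ s.alive, ∑ x ∈ s.cluster G z, f x = ∑ x ∈ s.alive, f x * (s.aliveDegree G x + 1) := by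
  rw [sum_comm' (t' := s.alive) (s' := fun x => s.cluster G x)]
  · exact sum_congr rfl fun x hx => by rw [sum_const, card_cluster hx, smul_eq_mul, mul_comm]
  · intro z x
    constructor
    · rintro ⟨hz, hx⟩
      exact ⟨(mem_cluster_comm (cluster_subset hx) hz).1 hx, cluster_subset hx⟩
    · rintro ⟨hz, hx⟩
      exact ⟨cluster_subset hz, (mem_cluster_comm (cluster_subset hz) hx).1 hz⟩

/-- The cancellation behind the potential argument: reversing the induced paths `z - u - x` of alive
vertices turns the loads passed on by pivots into the loads destroyed on cut edges. -/
theorem sum_load_mul_cutEdges :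
    ∑ z ∈ s.alive, s.load z * s.cutEdges G z =
      ∑ z ∈ s.alive, ∑ x ∈ s.alive \ s.cluster G z,
        s.load x * #{u ∈ s.cluster G z | G.Adj x u} := by
  have key : ∀ z ∈ s.alive, ∀ x ∈ s.alive \ s.cluster G z,
      #{u ∈ s.cluster G z | G.Adj x u} = #{u ∈ s.cluster G x | G.Adj z u} := by
    intro z hz x hx
    congr 1
    ext u
    simp only [mem_sdiff, mem_cluster, mem_filter, not_and, not_or] at hx ⊢
    have h1 := hx.2 hx.1
    constructor
    · rintro ⟨⟨hu, rfl | h⟩, h'⟩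
      · exact absurd h'.symm h1.2
      · exact ⟨⟨hu, Or.inr h'⟩, h⟩
    · rintro ⟨⟨hu, rfl | h⟩, h'⟩
      · exact absurd h' h1.2
      · exact ⟨⟨hu, Or.inr h'⟩, h⟩
  calc _ = ∑ z ∈ s.alive, ∑ x ∈ s.alive \ s.cluster G z,
        s.load z * #{u ∈ s.cluster G x | G.Adj z u} := by
        refine sum_congr rfl fun z hz => ?_
        rw [cutEdges, if_pos hz, mul_sum]
        exact sum_congr rfl fun x hx => by rw [key z hz x hx]
    _ = _ := by
        refine sum_comm' fun z x => ?_
        simp only [mem_sdiff]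
        constructor
        · rintro ⟨hz, hx, h⟩
          exact ⟨⟨hz, fun h' => h ((mem_cluster_comm hx hz).2 h')⟩, hx⟩
        · rintro ⟨⟨hz, h⟩, hx⟩
          exact ⟨hz, hx, fun h' => h ((mem_cluster_comm hx hz).1 h')⟩

/-- Listing an alive vertex `z` passes `1 + load z` on across each cut edge, and destroys the
pending load of the dying vertices and the load on all edges that lose an end. -/
theorem potential_step_of_mem (hU : s.alive ⊆ s.remaining) (hz : z ∈ s.alive) :
    (s.step G z).potential G + ∑ x ∈ s.cluster G z, s.pendingMark G x + s.killedLoad G z +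
        ∑ x ∈ s.alive \ s.cluster G z, s.load x * #{u ∈ s.cluster G z | G.Adj x u} =
      s.potential G + s.cutEdges G z + s.load z * s.cutEdges G z := by
  have hA := cluster_subset (s := s) (G := G) (z := z)
  have hzc : z ∈ s.cluster G z := by simp [mem_cluster, hz]
  have e1 : ∑ x ∈ (s.step G z).alive, (s.step G z).pendingMark G x =
      ∑ x ∈ s.alive \ s.cluster G z, s.pendingMark G x + (1 + s.load z) * s.cutEdges G z := by
    rw [cutEdges, if_pos hz, mul_sum, ← sum_add_distrib]
    simp only [step, if_pos hz]
    refine sum_congr rfl fun x hx => ?_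
    have hxz : ¬ G.Adj x z := by
      simp only [mem_sdiff, mem_cluster, not_and, not_or] at hx
      exact fun h => (hx.2 hx.1).2 h.symm
    simp only [pendingMark]
    have : {u ∈ s.remaining.erase z \ (s.alive \ s.cluster G z) | G.Adj x u} =
        {u ∈ s.remaining \ s.alive | G.Adj x u} ∪ {u ∈ s.cluster G z | G.Adj x u} := by
      ext u
      simp only [mem_filter, mem_sdiff, mem_erase, mem_union, not_and, not_not]
      constructor
      · rintro ⟨⟨⟨h1, h2⟩, h3⟩, h4⟩
        by_cases hu : u ∈ s.alive <;> tauto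
      · rintro (⟨⟨h1, h2⟩, h3⟩ | ⟨h1, h2⟩)
        · refine ⟨⟨⟨?_, h1⟩, fun h => absurd h h2⟩, h3⟩
          rintro rfl; exact h2 hz
        · refine ⟨⟨⟨?_, hU (hA h1)⟩, fun _ => h1⟩, h2⟩
          rintro rfl; exact hxz h2
    rw [this, sum_union]
    · congr 1
      · refine sum_congr rfl fun u hu => if_neg fun h => ?_
        simp only [mem_filter, mem_sdiff] at hu
        exact hu.1.2 (hA h)
      · rw [mul_comm, ← smul_eq_mul, ← sum_const]
        exact sum_congr rfl fun u hu => if_pos (mem_filter.1 hu).1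
    · rw [disjoint_left]
      intro u h h'
      simp only [mem_filter, mem_sdiff] at h h'
      exact h.1.2 (hA h'.1)
  have e2 : ∑ x ∈ (s.step G z).alive, (s.step G z).load x * (s.step G z).aliveDegree G x +
      ∑ x ∈ s.alive \ s.cluster G z, s.load x * #{u ∈ s.cluster G z | G.Adj x u} =
      ∑ x ∈ s.alive \ s.cluster G z, s.load x * s.aliveDegree G x := by
    simp only [step, if_pos hz, aliveDegree]
    rw [← sum_add_distrib]
    refine sum_congr rfl fun x hx => ?_
    rw [← mul_add]
    congr 1
    rw [← card_union_of_disjoint, ← filter_union, sdiff_union_of_subset hA]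
    exact disjoint_filter_filter sdiff_disjoint
  have e3 := sum_sdiff (f := fun x => s.pendingMark G x) hA
  have e4 := sum_sdiff (f := fun x => s.load x * s.aliveDegree G x) hA
  rw [potential, potential, killedLoad, if_pos hz, e1]
  linarith

/-- Listing a dead vertex turns its mark from pending load into load. -/
theorem potential_step_of_notMem (hU : z ∈ s.remaining) (hz : z ∉ s.alive) :
    (s.step G z).potential G + ∑ x ∈ s.alive with G.Adj x z, s.mark z =
      s.potential G + ∑ x ∈ s.alive with G.Adj x z, s.mark z * s.aliveDegree G x := by
  have e1 : ∑ x ∈ s.alive, (s.step G z).pendingMark G x +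
      ∑ x ∈ s.alive with G.Adj x z, s.mark z = ∑ x ∈ s.alive, s.pendingMark G x := by
    rw [sum_filter, ← sum_add_distrib]
    refine sum_congr rfl fun x hx => ?_
    simp only [step, if_neg hz, pendingMark]
    rw [erase_sdiff_comm, filter_erase]
    by_cases h : G.Adj x z
    · rw [if_pos h, sum_erase_add]
      simp [hU, hz, h]
    · rw [if_neg h, erase_eq_of_notMem (by simp [h]), add_zero]
  have e2 : ∑ x ∈ s.alive, (s.step G z).load x * (s.step G z).aliveDegree G x =
      ∑ x ∈ s.alive, s.load x * s.aliveDegree G x +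
        ∑ x ∈ s.alive with G.Adj x z, s.mark z * s.aliveDegree G x := by
    rw [sum_filter, ← sum_add_distrib]
    refine sum_congr rfl fun x hx => ?_
    simp only [step, if_neg hz, aliveDegree, G.adj_comm z x]
    split_ifs <;> ring
  have e3 : (s.step G z).alive = s.alive := by simp [step, hz]
  rw [potential, potential, e3]
  linarith

/-- If the next vertex is uniformly random, then the expected increase of the potential, plus the
expected killed load, is at most the expected number of cut edges. -/
theorem sum_potential_step_le (hU : s.alive ⊆ s.remaining) :
    ∑ z ∈ s.remaining, ((s.step G z).potential G + s.killedLoad G z) ≤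
      ∑ z ∈ s.remaining, (s.potential G + s.cutEdges G z) := by
  have hkill : ∀ z ∈ s.remaining \ s.alive, s.killedLoad G z = 0 := fun z h => by
    simp [killedLoad, (mem_sdiff.1 h).2]
  have hcut : ∀ z ∈ s.remaining \ s.alive, s.cutEdges G z = 0 := fun z h => by
    simp [cutEdges, (mem_sdiff.1 h).2]
  have h1 := sum_congr rfl fun z (hz : z ∈ s.alive) => potential_step_of_mem (G := G) hU hz
  have h2 := sum_congr rfl fun z (hz : z ∈ s.remaining \ s.alive) =>
    potential_step_of_notMem (G := G) (mem_sdiff.1 hz).1 (mem_sdiff.1 hz).2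
  simp only [sum_add_distrib] at h1 h2 ⊢
  rw [sum_load_mul_cutEdges, sum_sum_cluster] at h1
  -- reordering the transfers by their receivers
  have hcomm : ∀ f : V → ℕ, ∑ z ∈ s.remaining \ s.alive, ∑ x ∈ s.alive with G.Adj x z,
      s.mark z * f x = ∑ x ∈ s.alive, s.pendingMark G x * f x := by
    intro f
    simp only [pendingMark, sum_mul]
    refine sum_comm' fun z x => ?_
    simp only [mem_filter]
    tauto
  have h3 := hcomm fun _ => 1
  have h4 := hcomm (s.aliveDegree G)
  simp only [mul_one] at h3
  simp only [mul_add, mul_one, sum_add_distrib] at h1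
  rw [h3, h4] at h2
  rw [← sum_sdiff hU, ← sum_sdiff hU (f := fun z => s.killedLoad G z),
    ← sum_sdiff hU (f := fun _ => s.potential G), ← sum_sdiff hU (f := fun z => s.cutEdges G z),
    sum_eq_zero hkill, sum_eq_zero hcut]
  omega

end PivotState

/-! ### Errors of sequential Pivot and bad triangles -/

section BadTriangle

variable {V : Type*} {G : SimpleGraph V}

/-- Three distinct vertices with exactly two edges among them. -/
def IsBadTriangle (G : SimpleGraph V) (x y z : V) : Prop :=
  x ≠ y ∧ x ≠ z ∧ y ≠ z ∧ ((G.Adj x y ∧ G.Adj x z ∧ ¬ G.Adj y z) ∨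
    (G.Adj x y ∧ ¬ G.Adj x z ∧ G.Adj y z) ∨ (¬ G.Adj x y ∧ G.Adj x z ∧ G.Adj y z))

theorem IsBadTriangle.rotate {x y z : V} (h : IsBadTriangle G x y z) :
    IsBadTriangle G y z x := by
  simp only [IsBadTriangle, G.adj_comm y x, G.adj_comm z x] at h ⊢
  have := h.1.symm
  have := h.2.1.symm
  tauto

theorem disagreement_of_isBadTriangle (S : Setoid V) {x y z : V} (h : IsBadTriangle G x y z) :
    (disagreement G S).Adj x y ∨ (disagreement G S).Adj y z ∨ (disagreement G S).Adj z x := by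
  obtain ⟨hxy, hxz, hyz, h⟩ := h
  have t1 : S x y → S y z → S x z := S.trans'
  have t2 : S x y → S x z → S y z := fun a b => S.trans' (S.symm' a) b
  have t3 : S x z → S y z → S x y := fun a b => S.trans' a (S.symm' b)
  have s1 : S z x ↔ S x z := ⟨S.symm', S.symm'⟩
  simp only [disagreement, G.adj_comm z x, s1]
  have := hxz.symm
  tauto

theorem sum_sum_sum_rotate (A : Finset V) (f : V → V → V → ℕ) :
    ∑ x ∈ A, ∑ y ∈ A, ∑ z ∈ A, f x y z = ∑ x ∈ A, ∑ y ∈ A, ∑ z ∈ A, f y z x := by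
  conv_rhs => rw [sum_comm]
  exact sum_congr rfl fun _ _ => sum_comm

end BadTriangle

namespace PivotState

variable {V : Type*} [DecidableEq V] (G : SimpleGraph V) [DecidableRel G.Adj]

/-- The number of ordered pairs that meet the cluster created by listing `z` and on which this
cluster errs. -/
def pivotErrors (s : PivotState V) (z : V) : ℕ :=
  if z ∈ s.alive then
    #{q ∈ s.alive ×ˢ s.alive | q.1 ≠ q.2 ∧
      ((q.1 ∈ s.cluster G z ∧ q.2 ∈ s.cluster G z ∧ ¬ G.Adj q.1 q.2) ∨
        (q.1 ∈ s.cluster G z ∧ q.2 ∉ s.cluster G z ∧ G.Adj q.1 q.2) ∨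
        (q.1 ∉ s.cluster G z ∧ q.2 ∈ s.cluster G z ∧ G.Adj q.1 q.2))} else 0

/-- The number of ordered pairs of adjacent vertices in the cluster created by listing `z` that may
be separated by `r`-Pivot, because one of the ends or `z` has load at least `r`. -/
def deepEdges (r : ℕ) (s : PivotState V) (z : V) : ℕ :=
  if z ∈ s.alive then
    #{q ∈ s.cluster G z ×ˢ s.cluster G z | G.Adj q.1 q.2 ∧
      (r ≤ s.load q.1 ∨ r ≤ s.load q.2 ∨ r ≤ s.load z)} else 0

/-- The number of ordered pairs of alive vertices in relation `D`. -/
def alivePairs (D : V → V → Prop) [DecidableRel D] (s : PivotState V) : ℕ :=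
  #{q ∈ s.alive ×ˢ s.alive | D q.1 q.2}

variable {G} {s : PivotState V} {z : V}

theorem cutEdges_le_pivotErrors : s.cutEdges G z ≤ s.pivotErrors G z := by
  unfold cutEdges pivotErrors
  split_ifs with hz
  · rw [← card_sigma]
    refine card_le_card_of_injOn (fun q => (q.1, q.2)) ?_ ?_
    · rintro ⟨x, u⟩ h
      simp only [coe_sigma, Set.mem_sigma_iff, mem_coe, mem_sdiff, mem_filter] at h
      simp only [coe_filter, mem_product, Set.mem_ofPred_eq]
      exact ⟨⟨h.1.1, cluster_subset h.2.1⟩, h.2.2.ne, Or.inr (Or.inr ⟨h.1.2, h.2⟩)⟩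
    · rintro ⟨x, u⟩ _ ⟨x', u'⟩ _ h
      simp only [Prod.mk.injEq] at h
      rw [h.1, h.2]
  · exact le_rfl

theorem mul_deepEdges_le (r : ℕ) (s : PivotState V) (hz : z ∈ s.alive) :
    r * s.deepEdges G r z ≤ 2 * s.killedLoad G z +
      s.load z * (s.aliveDegree G z * (s.aliveDegree G z + 1)) := by
  rw [deepEdges, if_pos hz, killedLoad, if_pos hz]
  have hdeg : ∀ x, #{y ∈ s.cluster G z | G.Adj x y} ≤ s.aliveDegree G x := fun x =>
    card_le_card (filter_subset_filter _ cluster_subset)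
  have hsum : ∑ q ∈ s.cluster G z ×ˢ s.cluster G z with G.Adj q.1 q.2, s.load q.1 ≤
      ∑ x ∈ s.cluster G z, s.load x * s.aliveDegree G x := by
    rw [sum_filter, sum_product]
    refine sum_le_sum fun x _ => ?_
    simp only
    rw [← sum_filter, sum_const, smul_eq_mul, mul_comm]
    exact Nat.mul_le_mul_left _ (hdeg x)
  have hsymm : ∑ q ∈ s.cluster G z ×ˢ s.cluster G z with G.Adj q.1 q.2, s.load q.2 =
      ∑ q ∈ s.cluster G z ×ˢ s.cluster G z with G.Adj q.1 q.2, s.load q.1 := by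
    rw [sum_filter, sum_filter, sum_product, sum_product_right]
    simp only [G.adj_comm]
  have hcard : #{q ∈ s.cluster G z ×ˢ s.cluster G z | G.Adj q.1 q.2} ≤
      s.aliveDegree G z * (s.aliveDegree G z + 1) := by
    calc _ ≤ #(s.cluster G z).offDiag := card_le_card fun q hq => by
          simp only [mem_filter, mem_product] at hq
          exact mem_offDiag.2 ⟨hq.1.1, hq.1.2, hq.2.ne⟩
      _ = _ := by
        rw [offDiag_card, card_cluster hz, ← Nat.sub_one_mul]
        simp
  calc r * _ = ∑ q ∈ s.cluster G z ×ˢ s.cluster G z with G.Adj q.1 q.2 ∧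
        (r ≤ s.load q.1 ∨ r ≤ s.load q.2 ∨ r ≤ s.load z), r := by
        rw [sum_const, smul_eq_mul, mul_comm]
    _ ≤ ∑ q ∈ s.cluster G z ×ˢ s.cluster G z with G.Adj q.1 q.2 ∧
        (r ≤ s.load q.1 ∨ r ≤ s.load q.2 ∨ r ≤ s.load z),
          (s.load q.1 + s.load q.2 + s.load z) := by
        refine sum_le_sum fun q hq => ?_
        have := (mem_filter.1 hq).2.2
        omega
    _ ≤ ∑ q ∈ s.cluster G z ×ˢ s.cluster G z with G.Adj q.1 q.2,
          (s.load q.1 + s.load q.2 + s.load z) :=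
        sum_le_sum_of_subset (monotone_filter_right _ fun q _ h => h.1)
    _ ≤ _ := by
        rw [sum_add_distrib, sum_add_distrib, hsymm, sum_const, smul_eq_mul, mul_comm _ (s.load z)]
        have := Nat.mul_le_mul_left (s.load z) hcard
        omega

/-- A load of `z` is counted once for every ordered pair of the cluster, that is, `d * (d + 1)`
times for alive degree `d`. Over all `z` this is the killed load again, since `z` belongs to the
clusters of `d + 1` vertices. -/
theorem sum_mul_deepEdges_le (r : ℕ) (hU : s.alive ⊆ s.remaining) :
    ∑ z ∈ s.remaining, r * s.deepEdges G r z ≤ ∑ z ∈ s.remaining, 3 * s.killedLoad G z := by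
  rw [← sum_sdiff hU, ← sum_sdiff hU (f := fun z => 3 * s.killedLoad G z)]
  refine add_le_add (sum_le_sum fun z hz => ?_) ?_
  · simp [deepEdges, (mem_sdiff.1 hz).2]
  · refine (sum_le_sum fun z hz => mul_deepEdges_le (G := G) r s hz).trans (le_of_eq ?_)
    have : ∑ z ∈ s.alive, s.killedLoad G z =
        ∑ z ∈ s.alive, s.load z * (s.aliveDegree G z * (s.aliveDegree G z + 1)) := by
      simp only [← mul_assoc]
      rw [← sum_sum_cluster]
      exact sum_congr rfl fun z hz => by rw [killedLoad, if_pos hz]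
    rw [sum_add_distrib, ← this, ← sum_add_distrib]
    exact sum_congr rfl fun z _ => by ring

open Classical in
/-- One step of the 3-approximation: the errors are paid by the pairs that die and on which an
arbitrary clustering `S` disagrees with the graph. -/
theorem sum_pivotErrors_le (S : Setoid V) (hU : s.alive ⊆ s.remaining) :
    ∑ z ∈ s.remaining, (3 * (s.step G z).alivePairs (disagreement G S).Adj + s.pivotErrors G z) ≤
      ∑ _z ∈ s.remaining, 3 * s.alivePairs (disagreement G S).Adj := by
  set D := (disagreement G S).Adj
  rw [← sum_sdiff hU, ← sum_sdiff hU (f := fun _ => 3 * s.alivePairs D)]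
  refine add_le_add (sum_le_sum fun z hz => ?_) ?_
  · have := (mem_sdiff.1 hz).2
    simp [pivotErrors, step, this, alivePairs]
  let killed (z : V) : ℕ :=
    #{q ∈ s.alive ×ˢ s.alive | D q.1 q.2 ∧ (q.1 ∈ s.cluster G z ∨ q.2 ∈ s.cluster G z)}
  have hkill : ∀ z ∈ s.alive, (s.step G z).alivePairs D + killed z = s.alivePairs D := by
    intro z hz
    simp only [alivePairs, step, if_pos hz, killed]
    rw [← card_union_of_disjoint]
    · congr 1
      ext q
      simp only [mem_union, mem_filter, mem_product, mem_sdiff]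
      tauto
    · rw [disjoint_left]
      intro q
      simp only [mem_filter, mem_product, mem_sdiff]
      tauto
  have herr : ∀ z ∈ s.alive, s.pivotErrors G z =
      ∑ x ∈ s.alive, ∑ y ∈ s.alive, if IsBadTriangle G x y z then 1 else 0 := by
    intro z hz
    rw [pivotErrors, if_pos hz, card_filter, sum_product]
    refine sum_congr rfl fun x hx => sum_congr rfl fun y hy => ?_
    congr 1
    simp only [mem_cluster, hx, hy, true_and, IsBadTriangle, eq_iff_iff, G.adj_comm z x,
      G.adj_comm z y]
    by_cases hxz : x = z
    · subst hxz
      simp [eq_comm]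
      tauto
    · by_cases hyz : y = z
      · subst hyz
        simp [hxz]
      · simp only [hxz, hyz, false_or]
        tauto
  have hkilled : ∀ z ∈ s.alive, ∑ x ∈ s.alive, ∑ y ∈ s.alive,
      (if IsBadTriangle G x y z ∧ D x y then 1 else 0) ≤ killed z := by
    intro z _
    simp only [killed]
    rw [card_filter, sum_product]
    refine sum_le_sum fun x hx => sum_le_sum fun y hy => ?_
    by_cases h : IsBadTriangle G x y z ∧ D x y
    · rw [if_pos h, if_pos]
      refine ⟨h.2, ?_⟩
      have := h.1
      simp only [mem_cluster, hx, hy, true_and, IsBadTriangle, G.adj_comm z x,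
        G.adj_comm z y] at this ⊢
      tauto
    · rw [if_neg h]
      exact Nat.zero_le _
  have hrot : ∑ z ∈ s.alive, s.pivotErrors G z ≤ ∑ z ∈ s.alive, 3 * killed z := by
    let f (x y z : V) : ℕ := if IsBadTriangle G x y z ∧ D x y then 1 else 0
    have e1 : ∑ z ∈ s.alive, s.pivotErrors G z ≤ ∑ z ∈ s.alive, ∑ x ∈ s.alive, ∑ y ∈ s.alive,
        (f x y z + f y z x + f z x y) := by
      refine sum_le_sum fun z hz => ?_
      rw [herr z hz]
      refine sum_le_sum fun x hx => sum_le_sum fun y hy => ?_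
      by_cases h : IsBadTriangle G x y z
      · rw [if_pos h]
        have h2 := h.rotate
        have h3 := h2.rotate
        simp only [f, h, h2, h3, true_and]
        rcases disagreement_of_isBadTriangle S h with h | h | h <;> simp [D, h] <;> omega
      · simp [h]
    have e2 : ∑ z ∈ s.alive, ∑ x ∈ s.alive, ∑ y ∈ s.alive, f x y z ≤ ∑ z ∈ s.alive, killed z :=
      sum_le_sum fun z hz => hkilled z hz
    have e3 := sum_sum_sum_rotate s.alive fun z x y => f z x y
    have e4 := sum_sum_sum_rotate s.alive fun z x y => f y z x
    simp only [sum_add_distrib] at e1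
    rw [← mul_sum]
    omega
  have := sum_congr rfl hkill
  simp only [← mul_sum, sum_add_distrib] at this hrot ⊢
  omega

end PivotState

/-! ### Sequential Pivot on a random order -/

section PivotProcess

variable {V : Type*} [DecidableEq V] [Fintype V] (G : SimpleGraph V) [DecidableRel G.Adj] {n : ℕ}

/-- The state of sequential Pivot after listing the first `t` vertices of `o`; it no longer changes
after time `n`. -/
def pivotProcess (o : Fin n ≃ V) : ℕ → PivotState V
  | 0 => ⟨univ, univ, 0, 0⟩
  | t + 1 => if h : t < n then (pivotProcess o t).step G (o ⟨t, h⟩) else pivotProcess o t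

variable {G} {o : Fin n ≃ V}

@[simp] theorem pivotProcess_zero : pivotProcess G o 0 = ⟨univ, univ, 0, 0⟩ := rfl

theorem pivotProcess_succ (t : Fin n) :
    pivotProcess G o (t + 1) = (pivotProcess G o t).step G (o t) := by
  simp [pivotProcess]

theorem pivotProcess_swap {t j : Fin n} (h : t ≤ j) :
    ∀ i : ℕ, i ≤ t → pivotProcess G ((Equiv.swap t j).trans o) i = pivotProcess G o i
  | 0, _ => rfl
  | i + 1, hi => by
    have hin : i < n := by omega
    rw [pivotProcess_succ ⟨i, hin⟩, pivotProcess_succ ⟨i, hin⟩,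
      pivotProcess_swap h i (by omega), Equiv.trans_apply, Equiv.swap_apply_of_ne_of_ne]
    · exact Fin.ne_of_lt (by rw [Fin.lt_def]; simp only; omega)
    · exact Fin.ne_of_lt (by rw [Fin.lt_def]; simp only; omega)

theorem remaining_pivotProcess :
    ∀ t : ℕ, t ≤ n → (pivotProcess G o t).remaining = univ.filter fun v => t ≤ (o.symm v : ℕ)
  | 0, _ => by simp
  | t + 1, h => by
    rw [pivotProcess_succ ⟨t, h⟩]
    have : ((pivotProcess G o t).step G (o ⟨t, h⟩)).remaining =
        (pivotProcess G o t).remaining.erase (o ⟨t, h⟩) := by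
      rw [PivotState.step]; split_ifs <;> rfl
    rw [this, remaining_pivotProcess t (by omega)]
    ext v
    have hv : v = o ⟨t, h⟩ ↔ (o.symm v : ℕ) = t := by
      rw [← Equiv.symm_apply_eq, Fin.ext_iff]
    simp only [mem_erase, ne_eq, hv, mem_filter, mem_univ, true_and]
    omega

theorem alive_subset_remaining :
    ∀ t : ℕ, (pivotProcess G o t).alive ⊆ (pivotProcess G o t).remaining
  | 0 => by simp
  | t + 1 => by
    have ih := alive_subset_remaining t
    rw [pivotProcess]
    split_ifs with h
    · rw [PivotState.step]
      split_ifs with hz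
      · intro x hx
        simp only [mem_sdiff, mem_erase] at hx ⊢
        refine ⟨?_, ih hx.1⟩
        rintro rfl
        exact hx.2 (PivotState.mem_cluster.2 ⟨hz, Or.inl rfl⟩)
      · intro x hx
        exact mem_erase.2 ⟨fun h' => hz (h' ▸ hx), ih hx⟩
    · exact ih

/-- The principle of the deferred decision: an inequality that holds in every state on average over
the choice of the next vertex holds on average over all orders. -/
theorem sum_pivotProcess_le (t : Fin n) (F F' : PivotState V → V → ℕ)
    (h : ∀ s : PivotState V, s.alive ⊆ s.remaining →
      ∑ z ∈ s.remaining, F s z ≤ ∑ z ∈ s.remaining, F' s z) :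
    ∑ o : Fin n ≃ V, F (pivotProcess G o t) (o t) ≤
      ∑ o : Fin n ≃ V, F' (pivotProcess G o t) (o t) := by
  have key : ∀ F : PivotState V → V → ℕ,
      #(Ici t) * ∑ o : Fin n ≃ V, F (pivotProcess G o t) (o t) =
        ∑ o : Fin n ≃ V, ∑ z ∈ (pivotProcess G o t).remaining, F (pivotProcess G o t) z := by
    intro F
    -- swapping the entries `t` and `j` of the order preserves the state at time `t`
    have h1 : ∀ j ∈ Ici t, ∑ o : Fin n ≃ V, F (pivotProcess G o t) (o t) =
        ∑ o : Fin n ≃ V, F (pivotProcess G o t) (o j) := by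
      intro j hj
      refine Fintype.sum_equiv (Equiv.equivCongr (Equiv.swap t j) (Equiv.refl V)) _ _ fun o => ?_
      have : (Equiv.equivCongr (Equiv.swap t j) (Equiv.refl V)) o =
          (Equiv.swap t j).trans o := by
        ext; simp [Equiv.equivCongr]
      rw [this, pivotProcess_swap (mem_Ici.1 hj) t le_rfl, Equiv.trans_apply,
        Equiv.swap_apply_right]
    rw [← smul_eq_mul, ← sum_const, sum_congr rfl h1, sum_comm]
    refine sum_congr rfl fun o _ => ?_
    rw [remaining_pivotProcess t t.2.le]
    refine sum_equiv o (fun j => ?_) fun _ _ => rfl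
    simp
  have hpos : 0 < #(Ici t) := card_pos.2 ⟨t, mem_Ici.2 le_rfl⟩
  refine Nat.le_of_mul_le_mul_left ?_ hpos
  rw [key, key]
  exact sum_le_sum fun o _ => h _ (alive_subset_remaining t)

theorem sum_killedLoad_le :
    ∑ o : Fin n ≃ V, ∑ t : Fin n, (pivotProcess G o t).killedLoad G (o t) ≤
      ∑ o : Fin n ≃ V, ∑ t : Fin n, (pivotProcess G o t).cutEdges G (o t) := by
  let Φ (t : ℕ) : ℕ := ∑ o : Fin n ≃ V, (pivotProcess G o t).potential G
  have hstep : ∀ t : Fin n, Φ (t + 1) +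
      ∑ o : Fin n ≃ V, (pivotProcess G o t).killedLoad G (o t) ≤
        Φ t + ∑ o : Fin n ≃ V, (pivotProcess G o t).cutEdges G (o t) := by
    intro t
    have := sum_pivotProcess_le (G := G) t _ _ fun s hs =>
      PivotState.sum_potential_step_le (G := G) hs
    simpa only [Φ, pivotProcess_succ, sum_add_distrib] using this
  have h := sum_le_sum fun t (_ : t ∈ univ) => hstep t
  rw [sum_add_distrib, sum_add_distrib, Fin.sum_univ_eq_sum_range (fun t => Φ (t + 1)),
    Fin.sum_univ_eq_sum_range Φ] at h
  have h1 := sum_range_succ Φ n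
  have h2 := sum_range_succ' Φ n
  have h0 : Φ 0 = 0 := by simp [Φ, PivotState.potential, PivotState.pendingMark]
  rw [sum_comm, sum_comm (s := (univ : Finset (Fin n ≃ V)))]
  omega

open Classical in
theorem sum_pivotErrors_pivotProcess_le (S : Setoid V) :
    ∑ o : Fin n ≃ V, ∑ t : Fin n, (pivotProcess G o t).pivotErrors G (o t) ≤
      Fintype.card (Fin n ≃ V) * (3 * #{q : V × V | (disagreement G S).Adj q.1 q.2}) := by
  let Φ (t : ℕ) : ℕ :=
    ∑ o : Fin n ≃ V, 3 * (pivotProcess G o t).alivePairs (disagreement G S).Adj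
  have hstep : ∀ t : Fin n, Φ (t + 1) +
      ∑ o : Fin n ≃ V, (pivotProcess G o t).pivotErrors G (o t) ≤ Φ t := by
    intro t
    have := sum_pivotProcess_le (G := G) t _ _ fun s hs =>
      PivotState.sum_pivotErrors_le (G := G) S hs
    simpa only [Φ, pivotProcess_succ, sum_add_distrib] using this
  have h := sum_le_sum fun t (_ : t ∈ univ) => hstep t
  rw [sum_add_distrib, Fin.sum_univ_eq_sum_range (fun t => Φ (t + 1)),
    Fin.sum_univ_eq_sum_range Φ] at h
  have h1 := sum_range_succ Φ n
  have h2 := sum_range_succ' Φ n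
  have h0 : Φ 0 =
      Fintype.card (Fin n ≃ V) * (3 * #{q : V × V | (disagreement G S).Adj q.1 q.2}) := by
    simp [Φ, PivotState.alivePairs]
  rw [sum_comm]
  omega

/-- An upper bound for the number of ordered pairs on which `r`-Pivot errs when the vertices are
ordered by `o`. -/
def pivotErrorBound (G : SimpleGraph V) [DecidableRel G.Adj] (r : ℕ) (o : Fin n ≃ V) : ℕ :=
  ∑ t : Fin n, ((pivotProcess G o t).pivotErrors G (o t) +
    (pivotProcess G o t).deepEdges G r (o t))

open Classical in
theorem sum_pivotErrorBound_le (r : ℕ) (S : Setoid V) :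
    r * ∑ o : Fin n ≃ V, pivotErrorBound G r o ≤ Fintype.card (Fin n ≃ V) *
      ((3 * r + 9) * #{q : V × V | (disagreement G S).Adj q.1 q.2}) := by
  have h1 := sum_pivotErrors_pivotProcess_le (G := G) (n := n) S
  have h2 := sum_killedLoad_le (G := G) (n := n)
  have h3 : ∑ o : Fin n ≃ V, ∑ t : Fin n, (pivotProcess G o t).cutEdges G (o t) ≤
      ∑ o : Fin n ≃ V, ∑ t : Fin n, (pivotProcess G o t).pivotErrors G (o t) :=
    sum_le_sum fun o _ => sum_le_sum fun t _ => PivotState.cutEdges_le_pivotErrors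
  have h4 : ∑ o : Fin n ≃ V, ∑ t : Fin n, r * (pivotProcess G o t).deepEdges G r (o t) ≤
      ∑ o : Fin n ≃ V, ∑ t : Fin n, 3 * (pivotProcess G o t).killedLoad G (o t) := by
    rw [sum_comm, sum_comm (s := (univ : Finset (Fin n ≃ V)))]
    exact sum_le_sum fun t _ => sum_pivotProcess_le t
      (fun s z => r * s.deepEdges G r z) (fun s z => 3 * s.killedLoad G z)
      fun s hs => PivotState.sum_mul_deepEdges_le r hs
  simp only [← mul_sum] at h4
  simp only [pivotErrorBound, sum_add_distrib, mul_add]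
  nlinarith [Nat.mul_le_mul_left r h1]

end PivotProcess

/-! ### Pivots and loads along a fixed order -/

section GreedyPivots

variable {V : Type*} [DecidableEq V] [Fintype V] {G : SimpleGraph V} [DecidableRel G.Adj] {n : ℕ}
  {o : Fin n ≃ V}

/-- `v` is alive when it is listed, so that sequential Pivot makes it a pivot. -/
def IsGreedyPivot (G : SimpleGraph V) [DecidableRel G.Adj] (o : Fin n ≃ V) (v : V) : Prop :=
  v ∈ (pivotProcess G o (o.symm v)).alive

/-- `p` is the first pivot of sequential Pivot in the neighbourhood of `v`. -/
def IsFirstPivot (G : SimpleGraph V) [DecidableRel G.Adj] (o : Fin n ≃ V) (p v : V) : Prop :=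
  IsGreedyPivot G o p ∧ G.Adj p v ∧
    ∀ q, IsGreedyPivot G o q → G.Adj q v → (o.symm p : ℕ) ≤ o.symm q

theorem pivotProcess_symm_succ (v : V) :
    pivotProcess G o (o.symm v + 1) = (pivotProcess G o (o.symm v)).step G v := by
  rw [pivotProcess_succ, Equiv.apply_symm_apply]

theorem mem_alive_iff {v : V} : ∀ t : ℕ, t ≤ n → (v ∈ (pivotProcess G o t).alive ↔
    t ≤ (o.symm v : ℕ) ∧ ∀ p, IsGreedyPivot G o p → G.Adj p v → t ≤ (o.symm p : ℕ))
  | 0, _ => by simp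
  | t + 1, h => by
    obtain ⟨z, hz⟩ : ∃ z, (o.symm z : ℕ) = t := ⟨o ⟨t, h⟩, by simp⟩
    have hzv : ∀ v, v = z ↔ (o.symm v : ℕ) = t := fun v => by
      rw [← hz, ← Fin.ext_iff, o.symm.injective.eq_iff]
    have ih := mem_alive_iff (v := v) t (by omega)
    have hP : IsGreedyPivot G o z ↔ z ∈ (pivotProcess G o t).alive := by
      rw [IsGreedyPivot, hz]
    rw [← hz, pivotProcess_symm_succ, hz, PivotState.step]
    split_ifs with h'
    · simp only [mem_sdiff, PivotState.mem_cluster, not_and, not_or, ih]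
      constructor
      · rintro ⟨⟨h1, h2⟩, h3⟩
        have h4 := h3 ⟨h1, h2⟩
        rw [hzv] at h4
        refine ⟨by omega, fun p hp hpv => ?_⟩
        have h5 := h2 p hp hpv
        have : (o.symm p : ℕ) ≠ t := fun h6 => h4.2 ((hzv p).2 h6 ▸ hpv)
        omega
      · rintro ⟨h1, h2⟩
        refine ⟨⟨by omega, fun p hp hpv => ?_⟩, fun _ => ⟨?_, fun hzv' => ?_⟩⟩
        · have := h2 p hp hpv; omega
        · rw [hzv]; omega
        · have := h2 z (hP.2 h') hzv'; omega
    · have hv : v ∈ (pivotProcess G o t).alive → (o.symm v : ℕ) ≠ t :=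
        fun h1 h2 => h' ((hzv v).2 h2 ▸ h1)
      have hp : ∀ p, IsGreedyPivot G o p → (o.symm p : ℕ) ≠ t :=
        fun p h1 h2 => h' (hP.1 ((hzv p).2 h2 ▸ h1))
      constructor
      · intro h1
        have h2 := ih.1 h1
        have h3 := hv h1
        refine ⟨by omega, fun p h4 h5 => ?_⟩
        have := h2.2 p h4 h5
        have := hp p h4
        omega
      · rintro ⟨h1, h2⟩
        refine ih.2 ⟨by omega, fun p h3 h4 => ?_⟩
        have := h2 p h3 h4
        omega

/-- The inequality is strict in fact, as `p ≠ v`. -/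
theorem isGreedyPivot_iff {v : V} : IsGreedyPivot G o v ↔
    ∀ p, IsGreedyPivot G o p → G.Adj p v → (o.symm v : ℕ) ≤ o.symm p := by
  conv_lhs => rw [IsGreedyPivot, mem_alive_iff _ (o.symm v).2.le]
  simp

theorem IsGreedyPivot.not_adj {p q : V} (hp : IsGreedyPivot G o p) (hq : IsGreedyPivot G o q) :
    ¬ G.Adj p q := fun h => by
  have h1 := isGreedyPivot_iff.1 hp q hq h.symm
  have h2 := isGreedyPivot_iff.1 hq p hp h
  exact h.ne (o.symm.injective (Fin.ext (le_antisymm h1 h2)))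

theorem exists_isFirstPivot {v : V} (hv : ¬ IsGreedyPivot G o v) :
    ∃ p, IsFirstPivot G o p v ∧ (o.symm p : ℕ) < o.symm v := by
  classical
  have hv' := hv
  rw [isGreedyPivot_iff] at hv'
  push Not at hv'
  obtain ⟨p, hp, hpv, hlt⟩ := hv'
  obtain ⟨q, hq, hmin⟩ := exists_min_image {q | IsGreedyPivot G o q ∧ G.Adj q v}
    (fun q => (o.symm q : ℕ)) ⟨p, by simp [hp, hpv]⟩
  simp only [mem_filter, mem_univ, true_and] at hq hmin
  exact ⟨q, ⟨hq.1, hq.2, fun q' h1 h2 => hmin q' ⟨h1, h2⟩⟩, (hmin p ⟨hp, hpv⟩).trans_lt hlt⟩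

theorem IsFirstPivot.eq {p q v : V} (hp : IsFirstPivot G o p v) (hq : IsFirstPivot G o q v) :
    p = q :=
  o.symm.injective (Fin.ext (le_antisymm (hp.2.2 q hq.1 hq.2.1) (hq.2.2 p hp.1 hp.2.1)))

theorem IsFirstPivot.not_isGreedyPivot {p v : V} (h : IsFirstPivot G o p v) :
    ¬ IsGreedyPivot G o v := fun h' => h.1.not_adj h' h.2.1

theorem IsFirstPivot.lt {p v : V} (h : IsFirstPivot G o p v) :
    (o.symm p : ℕ) < o.symm v := by
  obtain ⟨q, hq, hlt⟩ := exists_isFirstPivot h.not_isGreedyPivot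
  rwa [h.eq hq]

theorem IsFirstPivot.mem_alive_iff {p v : V} (h : IsFirstPivot G o p v) {t : ℕ} (ht : t ≤ n) :
    v ∈ (pivotProcess G o t).alive ↔ t ≤ (o.symm p : ℕ) := by
  rw [_root_.mem_alive_iff t ht]
  refine ⟨fun h' => h'.2 p h.1 h.2.1, fun h' => ⟨h'.trans h.lt.le, fun q hq hqv => ?_⟩⟩
  exact h'.trans (h.2.2 q hq hqv)

/-- Once its first pivot `p` is listed, `v` carries for ever the mark that it received from `p`. -/
theorem IsFirstPivot.mark_eq {p v : V} (h : IsFirstPivot G o p v) : ∀ t : ℕ, t ≤ n →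
    (o.symm p : ℕ) < t →
    (pivotProcess G o t).mark v = 1 + (pivotProcess G o (o.symm p)).load p
  | 0, _, h0 => by omega
  | t + 1, htn, hlt => by
    obtain ⟨z, hz⟩ : ∃ z, (o.symm z : ℕ) = t := ⟨o ⟨t, htn⟩, by simp⟩
    have hmem := h.mem_alive_iff (t := t) (by omega)
    rw [← hz, pivotProcess_symm_succ, hz]
    rcases Nat.lt_or_ge (o.symm p) t with h1 | h1
    · have ih := h.mark_eq t (by omega) h1
      rw [PivotState.step]
      split_ifs with h2
      · simp only
        rw [if_neg, ih]
        exact fun h3 => absurd (hmem.1 (PivotState.cluster_subset h3)) (by omega)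
      · exact ih
    · have h2 : (o.symm p : ℕ) = t := by omega
      have h3 : z = p := o.symm.injective (Fin.ext (hz.trans h2.symm))
      subst h3
      have h4 : z ∈ (pivotProcess G o t).alive := by
        have := h.1
        rwa [IsGreedyPivot, hz] at this
      rw [PivotState.step, if_pos h4]
      simp only
      rw [if_pos, hz]
      exact PivotState.mem_cluster.2 ⟨hmem.2 h2.ge, Or.inr h.2.1⟩

theorem load_le_load_succ (x : V) (t : ℕ) :
    (pivotProcess G o t).load x ≤ (pivotProcess G o (t + 1)).load x := by
  rw [pivotProcess]
  split_ifs
  · rw [PivotState.step]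
    split_ifs
    · exact le_rfl
    · exact Nat.le_add_right _ _
  · exact le_rfl

/-- Chains through `v` lengthen: a neighbour of `v` has greater load than the first pivot of `v`,
once `v` is listed. -/
theorem IsFirstPivot.lt_load {p v x : V} (h : IsFirstPivot G o p v) (hx : G.Adj v x) {t : ℕ}
    (ht : (o.symm v : ℕ) < t) :
    (pivotProcess G o (o.symm p)).load p < (pivotProcess G o t).load x := by
  refine lt_of_lt_of_le ?_ (monotone_nat_of_le_succ (load_le_load_succ x) (Nat.succ_le_of_lt ht))
  rw [Nat.succ_eq_add_one, pivotProcess_symm_succ, PivotState.step,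
    if_neg (show v ∉ _ from h.not_isGreedyPivot), h.mark_eq _ (o.symm v).2.le h.lt]
  simp only [if_pos hx]
  omega

end GreedyPivots

/-! ### `r`-Pivot against sequential Pivot -/

section Priority

variable {V α : Type*} [LinearOrder α] {π : V → α} {n : ℕ} {o : Fin n ≃ V}

theorem priority_lt_iff (ho : StrictMono (π ∘ o)) {u v : V} :
    π u < π v ↔ (o.symm u : ℕ) < o.symm v := by
  have := ho.lt_iff_lt (a := o.symm u) (b := o.symm v)
  simp only [Function.comp_apply, Equiv.apply_symm_apply] at this
  exact this

theorem priority_le_iff (ho : StrictMono (π ∘ o)) {u v : V} :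
    π u ≤ π v ↔ (o.symm u : ℕ) ≤ o.symm v := by
  rw [← not_lt, priority_lt_iff ho, not_lt]

theorem priority_injective (ho : StrictMono (π ∘ o)) : Function.Injective π := by
  simpa [Function.comp_assoc] using ho.injective.comp o.symm.injective

theorem rPivotCenter_eq_of_joinsPivot {G : SimpleGraph V} (hπ : Function.Injective π) {r : ℕ}
    {u p : V} (h : JoinsPivot G π r u p) : rPivotCenter G π r u = p := by
  have hex : ∃ p, JoinsPivot G π r u p := ⟨p, h⟩
  rw [rPivotCenter, dif_pos hex]
  have h' := hex.choose_spec
  exact hπ (le_antisymm (h'.2.1.2.2 _ h.2.1.1 h.2.1.2.1) (h.2.1.2.2 _ h'.2.1.1 h'.2.1.2.1))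

end Priority

section Truncation

variable {V : Type*} [DecidableEq V] [Fintype V] {G : SimpleGraph V} [DecidableRel G.Adj] {n : ℕ}
  {o : Fin n ≃ V} {α : Type*} [LinearOrder α] {π : V → α}

theorem isGreedyPivot_of_mem_rPivots (ho : StrictMono (π ∘ o)) :
    ∀ (r : ℕ) {v : V}, v ∈ rPivots G π r → IsGreedyPivot G o v
  | 0, v, h => h.elim
  | r + 1, v, h => by
    rcases h with h | ⟨hv, hmin⟩
    · exact isGreedyPivot_of_mem_rPivots ho r h
    · rw [isGreedyPivot_iff]
      intro p hp hpv
      by_contra! hlt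
      have hset : p ∈ settledBy G (rPivots G π r) := by
        by_contra hset
        exact absurd ((priority_lt_iff ho).1 (hmin p hpv.symm hset)) (by omega)
      rcases hset with hset | ⟨q, hq, hqp⟩
      · exact hv (Or.inr ⟨p, hset, hpv⟩)
      · exact (isGreedyPivot_of_mem_rPivots ho r hq).not_adj hp hqp

theorem IsGreedyPivot.notMem_settledBy (ho : StrictMono (π ∘ o)) {r : ℕ} {v : V}
    (hv : IsGreedyPivot G o v) (h : v ∉ rPivots G π r) : v ∉ settledBy G (rPivots G π r) := by
  rintro (h' | ⟨q, hq, hqv⟩)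
  · exact h h'
  · exact (isGreedyPivot_of_mem_rPivots ho r hq).not_adj hv hqv

/-- A pivot `v` missed by `r + 1` rounds waits for an earlier neighbour that is unsettled after `r`
rounds, whose first pivot is therefore missed by `r` rounds. -/
theorem IsGreedyPivot.le_load (ho : StrictMono (π ∘ o)) :
    ∀ (r : ℕ) {v : V}, IsGreedyPivot G o v → v ∉ rPivots G π r →
      r ≤ (pivotProcess G o (o.symm v)).load v
  | 0, _, _, _ => Nat.zero_le _
  | r + 1, v, hv, h => by
    have h1 : v ∉ rPivots G π r := fun h' => h (Or.inl h')
    have h2 : ¬ ∀ u, G.Adj v u → u ∉ settledBy G (rPivots G π r) → π v < π u :=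
      fun h' => h (Or.inr ⟨hv.notMem_settledBy ho h1, h'⟩)
    push Not at h2
    obtain ⟨u, hvu, hu, hle⟩ := h2
    have hnp : ¬ IsGreedyPivot G o u := fun h' => hv.not_adj h' hvu
    obtain ⟨p, hp, -⟩ := exists_isFirstPivot hnp
    have hpr : p ∉ rPivots G π r := fun h' => hu (Or.inr ⟨p, h', hp.2.1⟩)
    have hlt : (o.symm u : ℕ) < o.symm v := by
      rw [priority_le_iff ho] at hle
      refine lt_of_le_of_ne hle fun h' => hvu.ne (o.symm.injective (Fin.ext h')).symm
    exact (IsGreedyPivot.le_load ho r hp.1 hpr).trans_lt (hp.lt_load hvu.symm hlt)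

/-- `r`-Pivot never joins a vertex to the wrong pivot: a missed first pivot is an unsettled vertex
that precedes all pivots found. -/
theorem JoinsPivot.isFirstPivot (ho : StrictMono (π ∘ o)) {r : ℕ} {u p : V}
    (h : JoinsPivot G π r u p) : IsFirstPivot G o p u := by
  obtain ⟨-, ⟨hp, hup, hmin⟩, hw⟩ := h
  have hpP := isGreedyPivot_of_mem_rPivots ho r hp
  obtain ⟨f, hf, -⟩ := exists_isFirstPivot fun h' => hpP.not_adj h' hup.symm
  by_cases hfr : f ∈ rPivots G π r
  · have h1 := (priority_le_iff ho).1 (hmin f hfr hf.2.1.symm)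
    exact ⟨hpP, hup.symm, fun q hq hqu => h1.trans (hf.2.2 q hq hqu)⟩
  · refine absurd ⟨f, hf.2.1.symm, hf.1.notMem_settledBy ho hfr, fun q hq huq => ?_⟩ hw
    rw [priority_lt_iff ho]
    refine lt_of_le_of_ne (hf.2.2 q (isGreedyPivot_of_mem_rPivots ho r hq) huq.symm) fun h' => ?_
    exact hfr (o.symm.injective (Fin.ext h') ▸ hq)

theorem rPivotCenter_eq_or (ho : StrictMono (π ∘ o)) (r : ℕ) (u : V) :
    rPivotCenter G π r u = u ∨ IsFirstPivot G o (rPivotCenter G π r u) u := by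
  by_cases hex : ∃ p, JoinsPivot G π r u p
  · obtain ⟨p, hp⟩ := hex
    rw [rPivotCenter_eq_of_joinsPivot (priority_injective ho) hp]
    exact Or.inr (hp.isFirstPivot ho)
  · rw [rPivotCenter, dif_neg hex]
    exact Or.inl rfl

/-- If `x` failed to join `z`, then `z` would be missed or an unsettled neighbour of `x` would
precede `z`; either way there is a long chain, which shows up in the load of `z` or of `x`. -/
theorem rPivotCenter_eq_of_mem_cluster (ho : StrictMono (π ∘ o)) {r : ℕ} {x z : V}
    (hz : IsGreedyPivot G o z)
    (hx : x ∈ (pivotProcess G o (o.symm z)).cluster G z)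
    (hlz : (pivotProcess G o (o.symm z)).load z < r)
    (hlx : (pivotProcess G o (o.symm z)).load x < r) : rPivotCenter G π r x = z := by
  have hzr : z ∈ rPivots G π r := by
    by_contra h
    exact absurd (hz.le_load ho r h) (by omega)
  obtain ⟨hxa, rfl | hzx⟩ := PivotState.mem_cluster.1 hx
  · rw [rPivotCenter, dif_neg]
    rintro ⟨p, hp⟩
    exact hp.1 hzr
  · rw [mem_alive_iff _ (o.symm z).2.le] at hxa
    have hfirst : IsFirstPivot G o z x := ⟨hz, hzx, hxa.2⟩
    refine rPivotCenter_eq_of_joinsPivot (priority_injective ho) ⟨fun h => hfirst.not_isGreedyPivot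
      (isGreedyPivot_of_mem_rPivots ho r h), ⟨hzr, hzx.symm, fun q hq hxq => ?_⟩, ?_⟩
    · rw [priority_le_iff ho]
      exact hfirst.2.2 q (isGreedyPivot_of_mem_rPivots ho r hq) hxq.symm
    · rintro ⟨w, hxw, hw, hlt⟩
      have hwz := (priority_lt_iff ho).1 (hlt z hzr hzx.symm)
      have hwP : ¬ IsGreedyPivot G o w := fun h => by
        have := hfirst.2.2 w h hxw.symm
        omega
      obtain ⟨p, hp, -⟩ := exists_isFirstPivot hwP
      have hpr : p ∉ rPivots G π r := fun h => hw (Or.inr ⟨p, h, hp.2.1⟩)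
      have h1 := hp.1.le_load ho r hpr
      have h2 := hp.lt_load hxw.symm hwz
      omega

/-- For any two vertices there is a step at which the first of them dies. -/
theorem exists_last_alive (o : Fin n ≃ V) (x y : V) : ∃ z : V, IsGreedyPivot G o z ∧
    x ∈ (pivotProcess G o (o.symm z)).alive ∧ y ∈ (pivotProcess G o (o.symm z)).alive ∧
    (x ∈ (pivotProcess G o (o.symm z)).cluster G z ∨
      y ∈ (pivotProcess G o (o.symm z)).cluster G z) := by
  by_contra! h
  have key : ∀ t : ℕ, t ≤ n →
      x ∈ (pivotProcess G o t).alive ∧ y ∈ (pivotProcess G o t).alive := by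
    intro t
    induction t with
    | zero => simp
    | succ t ih =>
      intro ht
      obtain ⟨hx, hy⟩ := ih (by omega)
      obtain ⟨z, hz⟩ : ∃ z, (o.symm z : ℕ) = t := ⟨o ⟨t, ht⟩, by simp⟩
      have h1 := h z
      rw [IsGreedyPivot, hz] at h1
      rw [← hz, pivotProcess_symm_succ, hz, PivotState.step]
      split_ifs with h2
      · have h3 := h1 h2 hx hy
        exact ⟨mem_sdiff.2 ⟨hx, h3.1⟩, mem_sdiff.2 ⟨hy, h3.2⟩⟩
      · exact ⟨hx, hy⟩
  have h1 := (mem_alive_iff n le_rfl).1 (key n le_rfl).1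
  have := (o.symm x).2
  omega

open Classical in
/-- Every pair on which `r`-Pivot errs is charged to the step of sequential Pivot at which the first
of its vertices dies. -/
theorem card_disagreement_le (ho : StrictMono (π ∘ o)) (r : ℕ) :
    #{q : V × V | (disagreement G (rPivotClustering G π r)).Adj q.1 q.2} ≤
      pivotErrorBound G r o := by
  rw [pivotErrorBound]
  -- the sets counted by `PivotState.pivotErrors` and `PivotState.deepEdges`
  let errs (t : Fin n) : Finset (V × V) := if o t ∈ (pivotProcess G o t).alive then
    {q ∈ (pivotProcess G o t).alive ×ˢ (pivotProcess G o t).alive | q.1 ≠ q.2 ∧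
      ((q.1 ∈ (pivotProcess G o t).cluster G (o t) ∧
          q.2 ∈ (pivotProcess G o t).cluster G (o t) ∧ ¬ G.Adj q.1 q.2) ∨
        (q.1 ∈ (pivotProcess G o t).cluster G (o t) ∧
          q.2 ∉ (pivotProcess G o t).cluster G (o t) ∧ G.Adj q.1 q.2) ∨
        (q.1 ∉ (pivotProcess G o t).cluster G (o t) ∧
          q.2 ∈ (pivotProcess G o t).cluster G (o t) ∧ G.Adj q.1 q.2))} else ∅
  let deep (t : Fin n) : Finset (V × V) := if o t ∈ (pivotProcess G o t).alive then
    {q ∈ (pivotProcess G o t).cluster G (o t) ×ˢ (pivotProcess G o t).cluster G (o t) |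
      G.Adj q.1 q.2 ∧ (r ≤ (pivotProcess G o t).load q.1 ∨ r ≤ (pivotProcess G o t).load q.2 ∨
        r ≤ (pivotProcess G o t).load (o t))} else ∅
  have hcard : ∀ t, #(errs t ∪ deep t) ≤ (pivotProcess G o t).pivotErrors G (o t) +
      (pivotProcess G o t).deepEdges G r (o t) := by
    intro t
    refine (card_union_le _ _).trans (le_of_eq ?_)
    simp only [errs, deep, PivotState.pivotErrors, PivotState.deepEdges]
    split_ifs
    · congr!
    · simp
  refine le_trans (card_le_card (t := univ.biUnion fun t => errs t ∪ deep t) ?_)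
    (card_biUnion_le.trans (sum_le_sum fun t _ => hcard t))
  rintro ⟨x, y⟩ hxy
  obtain ⟨z, hz, hx, hy, hcl⟩ := exists_last_alive (G := G) o x y
  obtain ⟨hne, hxy⟩ := (mem_filter.1 hxy).2
  simp only at hne hxy
  rw [mem_biUnion]
  refine ⟨o.symm z, mem_univ _, ?_⟩
  have hz' := hz
  rw [IsGreedyPivot] at hz'
  simp only [errs, deep, Equiv.apply_symm_apply, if_pos hz', mem_union, mem_filter, mem_product,
    hx, hy, true_and, hne, ne_eq, not_false_eq_true]
  have hsame : (rPivotClustering G π r) x y ↔ rPivotCenter G π r x = rPivotCenter G π r y :=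
    Iff.rfl
  rw [hsame] at hxy
  -- a vertex that dies together with `z` is in its own cluster or in that of `z`
  have hcenter : ∀ x ∈ (pivotProcess G o (o.symm z)).cluster G z,
      rPivotCenter G π r x = x ∨ rPivotCenter G π r x = z := by
    intro x hx
    rcases rPivotCenter_eq_or (G := G) ho r x with h | h
    · exact Or.inl h
    · obtain ⟨hxa, rfl | hzx⟩ := PivotState.mem_cluster.1 hx
      · exact absurd hz h.not_isGreedyPivot
      · rw [mem_alive_iff _ (o.symm z).2.le] at hxa
        exact Or.inr (h.eq ⟨hz, hzx, hxa.2⟩)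
  -- vertices separated by `z` are in different clusters
  have hsep : ∀ x ∈ (pivotProcess G o (o.symm z)).cluster G z,
      ∀ y ∈ (pivotProcess G o (o.symm z)).alive,
      y ∉ (pivotProcess G o (o.symm z)).cluster G z →
      rPivotCenter G π r x ≠ rPivotCenter G π r y := by
    intro x hx y hya hy h
    have hyz : y ≠ z ∧ ¬ G.Adj z y := by
      simpa [PivotState.mem_cluster, hya] using hy
    rcases rPivotCenter_eq_or (G := G) ho r y with h1 | h1
    · rcases hcenter x hx with h2 | h2
      · exact hy (by rw [← h1, ← h, h2]; exact hx)
      · exact hyz.1 (by rw [← h1, ← h, h2])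
    · rcases hcenter x hx with h2 | h2
      · rw [← h, h2] at h1
        obtain ⟨-, rfl | hzx⟩ := PivotState.mem_cluster.1 hx
        · exact hyz.2 h1.2.1
        · exact hz.not_adj h1.1 hzx
      · rw [← h, h2] at h1
        exact hyz.2 h1.2.1
  by_cases hxc : x ∈ (pivotProcess G o (o.symm z)).cluster G z <;>
    by_cases hyc : y ∈ (pivotProcess G o (o.symm z)).cluster G z
  · by_cases hadj : G.Adj x y
    · right
      refine ⟨⟨hxc, hyc⟩, hadj, ?_⟩
      by_contra! hsmall
      refine hxy (iff_of_true hadj ?_)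
      rw [rPivotCenter_eq_of_mem_cluster ho hz hxc hsmall.2.2 hsmall.1,
        rPivotCenter_eq_of_mem_cluster ho hz hyc hsmall.2.2 hsmall.2.1]
    · exact Or.inl (Or.inl ⟨hxc, hyc, hadj⟩)
  · have := hsep x hxc y hy hyc
    exact Or.inl (Or.inr (Or.inl ⟨hxc, hyc, by tauto⟩))
  · have := (hsep y hyc x hx hxc).symm
    exact Or.inl (Or.inr (Or.inr ⟨hxc, hyc, by tauto⟩))
  · exact absurd hcl (by tauto)

end Truncation

/-! ### Independent random ranks -/

section RandomRanks

open Classical in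
theorem two_mul_clusteringCost {V : Type*} [Fintype V] (G : SimpleGraph V) (S : Setoid V) :
    2 * clusteringCost G S = #{q : V × V | (disagreement G S).Adj q.1 q.2} := by
  rw [clusteringCost, ← SimpleGraph.coe_edgeFinset, Set.ncard_coe_finset,
    SimpleGraph.two_mul_card_edgeFinset]

theorem exists_clusteringCost_eq_optCost {V : Type*} (G : SimpleGraph V) :
    ∃ S : Setoid V, clusteringCost G S = optCost G :=
  Nat.sInf_mem (Set.range_nonempty _)

/-- The order in which an injective function increases is unique. -/
theorem listing_unique {V : Type*} {n : ℕ} {f : V → ℕ} {o o' : Fin n ≃ V}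
    (hf : Function.Injective f) (h : StrictMono (f ∘ o)) (h' : StrictMono (f ∘ o')) : o = o' := by
  have h1 : f ∘ o = f ∘ o' := by
    rw [← h.range_inj h', EquivLike.range_comp, EquivLike.range_comp]
  ext i
  exact hf (congrFun h1 i)

variable {V : Type*} [Fintype V]

theorem two_mul_clusteringCost_le (G : SimpleGraph V) (S : Setoid V) :
    2 * clusteringCost G S ≤ Fintype.card V ^ 2 := by
  classical
  rw [two_mul_clusteringCost, sq, ← Fintype.card_prod]
  exact card_le_univ _

theorem exists_strictMono_listing {α : Type*} [LinearOrder α] {π : V → α}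
    (hπ : Function.Injective π) : ∃ o : Fin (Fintype.card V) ≃ V, StrictMono (π ∘ o) := by
  let _ : LinearOrder V := LinearOrder.lift' π hπ
  exact ⟨(Fintype.orderIsoFinOfCardEq V rfl).toEquiv,
    fun _ _ h => (Fintype.orderIsoFinOfCardEq V rfl).strictMono h⟩

/-- Priority by rank, ties being broken in favour of the smaller identifier. -/
def rankPriority {N : ℕ} (ident : V → ℕ) (ω : V → Fin N) (v : V) : ℕ ×ₗ ℕ :=
  toLex ((ω v : ℕ), ident v)

theorem exists_rank_listing {N : ℕ} {ident : V → ℕ} (hid : Function.Injective ident) :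
    ∃ L : (V → Fin N) → (Fin (Fintype.card V) ≃ V),
      ∀ ω, StrictMono (rankPriority ident ω ∘ L ω) := by
  have : ∀ ω : V → Fin N, ∃ o : Fin (Fintype.card V) ≃ V, StrictMono (rankPriority ident ω ∘ o) :=
    fun ω => exists_strictMono_listing fun u v h => by
      have := toLex.injective h
      exact hid (Prod.ext_iff.1 this).2
  choose L hL using this
  exact ⟨L, hL⟩

variable [DecidableEq V]

/-- Injective ranks induce a uniformly random order: permuting the vertices permutes the injective
rank assignments, and it runs through all orders for each of them. -/
theorem sum_injective_listing {N : ℕ} (B : (Fin (Fintype.card V) ≃ V) → ℕ)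
    (L : (V → Fin N) → (Fin (Fintype.card V) ≃ V))
    (hL : ∀ ω : V → Fin N, Function.Injective ω → StrictMono ((fun v => (ω v : ℕ)) ∘ L ω)) :
    Fintype.card (Fin (Fintype.card V) ≃ V) *
        ∑ ω : V → Fin N with Function.Injective ω, B (L ω) =
      #{ω : V → Fin N | Function.Injective ω} * ∑ o, B o := by
  have hshift : ∀ σ : Equiv.Perm V, ∑ ω : V → Fin N with Function.Injective ω, B (L ω) =
      ∑ ω : V → Fin N with Function.Injective ω, B ((L ω).trans σ) := by
    intro σ
    refine (sum_equiv (Equiv.arrowCongr σ (Equiv.refl (Fin N))) ?_ ?_).symm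
    · intro ω
      simp only [mem_filter, mem_univ, true_and]
      exact (σ.symm.injective_comp ω).symm
    · intro ω hω
      have hω := (mem_filter.1 hω).2
      have hω' : Function.Injective ((Equiv.arrowCongr σ (Equiv.refl (Fin N))) ω) :=
        hω.comp σ.symm.injective
      congr 1
      refine listing_unique (Fin.val_injective.comp hω') ?_ (hL _ hω')
      intro i j hij
      simpa using hL ω hω hij
  have hcard : Fintype.card (Fin (Fintype.card V) ≃ V) = #(univ : Finset (Equiv.Perm V)) := by
    rw [card_univ, Fintype.card_equiv (Fintype.equivFin V).symm, Fintype.card_perm,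
      Fintype.card_fin]
  rw [hcard, ← smul_eq_mul, ← sum_const, sum_congr rfl fun σ _ => hshift σ, sum_comm,
    ← smul_eq_mul, ← sum_const]
  refine sum_congr rfl fun ω _ => ?_
  exact Fintype.sum_equiv (Equiv.equivCongr (L ω).symm (Equiv.refl V)) _ _ fun σ => by
    congr 1

/-- The union bound for ties. -/
theorem mul_card_not_injective_le (N : ℕ) :
    N * #{ω : V → Fin N | ¬ Function.Injective ω} ≤ Fintype.card V ^ 2 * N ^ Fintype.card V := by
  have hpair : ∀ u v : V, u ≠ v → #{ω : V → Fin N | ω u = ω v} * N ≤ N ^ Fintype.card V := by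
    intro u v huv
    have : N ^ Fintype.card V = #(univ : Finset (V → Fin N)) := by simp
    rw [this]
    have hN : N = #(univ : Finset (Fin N)) := by simp
    conv_lhs => enter [2]; rw [hN]
    rw [← card_product]
    -- from a tie at `u` and `v`, the rank of `u` can be changed arbitrarily and recovered from `v`
    refine card_le_card_of_injOn (fun q => Function.update q.1 u q.2) (fun _ _ => by simp) ?_
    rintro ⟨ω, a⟩ hω ⟨ω', a'⟩ hω' h
    simp only [coe_product, coe_filter, Set.mem_prod, mem_univ, true_and, coe_univ,
      Set.mem_univ, and_true, Set.mem_ofPred_eq] at hω hω' h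
    have hne : ∀ w, w ≠ u → ω w = ω' w := fun w hw => by
      simpa [Function.update_of_ne hw] using congrFun h w
    have ha : a = a' := by simpa using congrFun h u
    have hωω' : ω = ω' := by
      ext w
      by_cases hw : w = u
      · rw [hw, hω, hω', hne v huv.symm]
      · rw [hne w hw]
    rw [ha, hωω']
  calc N * #{ω : V → Fin N | ¬ Function.Injective ω}
      ≤ N * #((univ : Finset V).offDiag.biUnion fun q => {ω : V → Fin N | ω q.1 = ω q.2}) := by
        refine Nat.mul_le_mul_left _ (card_le_card fun ω hω => ?_)
        have hω := (mem_filter.1 hω).2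
        simp only [Function.Injective] at hω
        push Not at hω
        obtain ⟨u, v, h, hne⟩ := hω
        rw [mem_biUnion]
        exact ⟨(u, v), by simp [hne], by simp [h]⟩
    _ ≤ ∑ q ∈ (univ : Finset V).offDiag, #{ω : V → Fin N | ω q.1 = ω q.2} * N := by
        rw [mul_comm, ← sum_mul]
        exact Nat.mul_le_mul_right _ card_biUnion_le
    _ ≤ ∑ q ∈ (univ : Finset V).offDiag, N ^ Fintype.card V :=
        sum_le_sum fun q hq => hpair _ _ (mem_offDiag.1 hq).2.2
    _ ≤ _ := by
        rw [sum_const, smul_eq_mul, offDiag_card, card_univ, sq]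
        exact Nat.mul_le_mul_right _ (Nat.sub_le _ _)

variable (G : SimpleGraph V) [DecidableRel G.Adj]

theorem mul_sum_pivotErrorBound_le_optCost (r : ℕ) :
    r * ∑ o : Fin (Fintype.card V) ≃ V, pivotErrorBound G r o ≤
      Fintype.card (Fin (Fintype.card V) ≃ V) * ((3 * r + 9) * (2 * optCost G)) := by
  classical
  obtain ⟨S, hS⟩ := exists_clusteringCost_eq_optCost G
  rw [← hS, two_mul_clusteringCost]
  exact sum_pivotErrorBound_le r S

theorem sum_injective_cost_le {N : ℕ} {ident : V → ℕ} (hid : Function.Injective ident) (r : ℕ) :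
    r * ∑ ω : V → Fin N with Function.Injective ω,
        clusteringCost G (rPivotClustering G (rankPriority ident ω) r) ≤
      #{ω : V → Fin N | Function.Injective ω} * ((3 * r + 9) * optCost G) := by
  classical
  obtain ⟨L, hL⟩ := exists_rank_listing (N := N) hid
  have h1 := sum_injective_listing (pivotErrorBound G r) L fun ω hω i j hij => by
    have := hL ω hij
    simp only [rankPriority, Function.comp_apply, Prod.Lex.toLex_lt_toLex] at this ⊢
    rcases this with h | ⟨h, -⟩
    · exact h
    · exact absurd ((L ω).injective (hω (Fin.ext h))) hij.ne
  have h2 := mul_sum_pivotErrorBound_le_optCost G r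
  have h3 : 2 * ∑ ω : V → Fin N with Function.Injective ω,
        clusteringCost G (rPivotClustering G (rankPriority ident ω) r) ≤
      ∑ ω : V → Fin N with Function.Injective ω, pivotErrorBound G r (L ω) := by
    rw [mul_sum]
    refine sum_le_sum fun ω _ => ?_
    rw [two_mul_clusteringCost]
    exact card_disagreement_le (hL ω) r
  have hpos : 0 < Fintype.card (Fin (Fintype.card V) ≃ V) :=
    Fintype.card_pos_iff.2 ⟨(Fintype.equivFin V).symm⟩
  refine Nat.le_of_mul_le_mul_left ?_ (Nat.mul_pos two_pos hpos)
  calc _ = r * (Fintype.card (Fin (Fintype.card V) ≃ V) *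
        (2 * ∑ ω : V → Fin N with Function.Injective ω,
        clusteringCost G (rPivotClustering G (rankPriority ident ω) r))) := by ring
    _ ≤ r * (Fintype.card (Fin (Fintype.card V) ≃ V) *
        ∑ ω : V → Fin N with Function.Injective ω, pivotErrorBound G r (L ω)) := by gcongr
    _ = #{ω : V → Fin N | Function.Injective ω} *
        (r * ∑ o : Fin (Fintype.card V) ≃ V, pivotErrorBound G r o) := by rw [h1]; ring
    _ ≤ #{ω : V → Fin N | Function.Injective ω} *
        (Fintype.card (Fin (Fintype.card V) ≃ V) * ((3 * r + 9) * (2 * optCost G))) := by gcongr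
    _ = _ := by ring

/-- If `opt = 0`, then the nonnegative error bound is zero on average, hence for every order. -/
theorem clusteringCost_eq_zero {α : Type*} [LinearOrder α] {π : V → α}
    (hπ : Function.Injective π) {r : ℕ} (hr : 0 < r) (hopt : optCost G = 0) :
    clusteringCost G (rPivotClustering G π r) = 0 := by
  classical
  obtain ⟨o, ho⟩ := exists_strictMono_listing hπ
  have h1 := mul_sum_pivotErrorBound_le_optCost G r
  rw [hopt] at h1
  have h2 : ∑ o : Fin (Fintype.card V) ≃ V, pivotErrorBound G r o = 0 := by
    simpa [hr.ne'] using h1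
  have h3 := sum_eq_zero_iff.1 h2 o (mem_univ _)
  have h4 := card_disagreement_le (G := G) ho r
  rw [← two_mul_clusteringCost] at h4
  omega

theorem sum_cost_le {N : ℕ} {ident : V → ℕ} (hid : Function.Injective ident) {r : ℕ}
    (hr : 0 < r) {δ : ℝ} (hδ : 2 ≤ Fintype.card V → (Fintype.card V : ℝ) ^ 4 ≤ δ * N)
    (hN : 0 < N) (hδ0 : 0 ≤ δ) :
    ∑ ω : V → Fin N, (clusteringCost G (rPivotClustering G (rankPriority ident ω) r) : ℝ) ≤
      (N : ℝ) ^ Fintype.card V * ((3 + 9 / r + δ) * optCost G) := by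
  have hr' : (0 : ℝ) < r := by exact_mod_cast hr
  have hN' : (0 : ℝ) < N := by exact_mod_cast hN
  rcases Nat.eq_zero_or_pos (optCost G) with h0 | hpos
  · rw [sum_eq_zero fun ω _ => ?_]
    · simp [h0]
    · rw [clusteringCost_eq_zero G (fun u v h => ?_) hr h0, Nat.cast_zero]
      exact hid (Prod.ext_iff.1 (toLex.injective h)).2
  have hcard2 : 2 ≤ Fintype.card V := by
    by_contra! hlt
    obtain ⟨S, hS⟩ := exists_clusteringCost_eq_optCost G
    have h1 := two_mul_clusteringCost_le G S
    have h2 : Fintype.card V ^ 2 ≤ 1 ^ 2 := Nat.pow_le_pow_left (by omega) 2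
    omega
  rw [← sum_filter_add_sum_filter_not univ (fun ω : V → Fin N => Function.Injective ω)]
  have h1 : ∑ ω : V → Fin N with Function.Injective ω,
      (clusteringCost G (rPivotClustering G (rankPriority ident ω) r) : ℝ) ≤
        (N : ℝ) ^ Fintype.card V * ((3 + 9 / r) * optCost G) := by
    have h := sum_injective_cost_le (N := N) G hid r
    have hle : #{ω : V → Fin N | Function.Injective ω} ≤ N ^ Fintype.card V :=
      (card_le_univ _).trans (by simp)
    have h' := h.trans (Nat.mul_le_mul_right _ hle)
    have h'' : (r : ℝ) * ∑ ω : V → Fin N with Function.Injective ω,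
        (clusteringCost G (rPivotClustering G (rankPriority ident ω) r) : ℝ) ≤
          (N : ℝ) ^ Fintype.card V * ((3 * r + 9) * optCost G) := by exact_mod_cast h'
    refine le_of_mul_le_mul_left (h''.trans (le_of_eq ?_)) hr'
    field_simp
  have h2 : ∑ ω : V → Fin N with ¬ Function.Injective ω,
      (clusteringCost G (rPivotClustering G (rankPriority ident ω) r) : ℝ) ≤
        (N : ℝ) ^ Fintype.card V * (δ * optCost G) := by
    have hcost : ∀ ω : V → Fin N,
        (clusteringCost G (rPivotClustering G (rankPriority ident ω) r) : ℝ) ≤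
          (Fintype.card V : ℝ) ^ 2 := fun ω => by
      have := two_mul_clusteringCost_le G (rPivotClustering G (rankPriority ident ω) r)
      exact_mod_cast (by omega :
        clusteringCost G (rPivotClustering G (rankPriority ident ω) r) ≤ Fintype.card V ^ 2)
    have hcard : (N : ℝ) * #{ω : V → Fin N | ¬ Function.Injective ω} ≤
        (Fintype.card V : ℝ) ^ 2 * (N : ℝ) ^ Fintype.card V := by
      exact_mod_cast mul_card_not_injective_le (V := V) N
    have hopt : (1 : ℝ) ≤ optCost G := by exact_mod_cast hpos
    refine le_of_mul_le_mul_left ?_ hN'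
    calc (N : ℝ) * _ ≤ N * (#{ω : V → Fin N | ¬ Function.Injective ω} *
          (Fintype.card V : ℝ) ^ 2) := by
          gcongr
          rw [← nsmul_eq_mul]
          exact sum_le_card_nsmul _ _ _ fun ω _ => hcost ω
      _ ≤ (Fintype.card V : ℝ) ^ 2 * (N : ℝ) ^ Fintype.card V * (Fintype.card V : ℝ) ^ 2 := by
          rw [← mul_assoc]
          gcongr
      _ = (N : ℝ) ^ Fintype.card V * (Fintype.card V : ℝ) ^ 4 := by ring
      _ ≤ (N : ℝ) ^ Fintype.card V * (δ * N * optCost G) := by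
          gcongr
          exact (hδ hcard2).trans (le_mul_of_one_le_right (by positivity) hopt)
      _ = _ := by ring
  calc _ ≤ _ := add_le_add h1 h2
    _ = _ := by ring

end RandomRanks

/-! ### The distributed algorithm -/

section LocalPivot

/-- What a processor knows about a neighbour. While keys are being transmitted, `key` is the number
formed by the digits received so far. -/
structure NeighborRecord where
  key : ℕ
  pivot : Bool
  settled : Bool

/-- The state of a processor. -/
structure NodeState where
  /-- The number of vertices of the network. -/
  size : ℕ
  /-- The priority of the vertex, encoded as an integer. -/
  key : ℕ
  /-- The number of rounds completed. -/
  time : ℕ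
  pivot : Bool
  settled : Bool
  /-- The records of the neighbours, in the order of the ports. -/
  neighbors : List NeighborRecord

namespace NodeState

/-- Whether the vertex is a pivot after the current round of `r`-Pivot. -/
def becomesPivot (s : NodeState) : Bool :=
  s.pivot || (!s.settled && s.neighbors.all fun e => e.settled || decide (s.key < e.key))

/-- The message to all neighbours: a digit of the key during the first `T` rounds, the least
significant one first; then alternately the new pivot bit and the new settled bit. -/
def message (T : ℕ) (s : NodeState) : List Bool :=
  if s.time < T then (s.key / s.size ^ s.time % s.size).bits
  else if (s.time - T) % 2 = 0 then [s.becomesPivot] else [s.settled]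

/-- The number with the given binary digits, the least significant one first. -/
def decodeNat (m : List Bool) : ℕ := Nat.ofDigits 2 (m.map fun b => cond b 1 0)

/-- The state after receiving the messages `ms`. -/
def update (T : ℕ) (s : NodeState) (ms : List (List Bool)) : NodeState :=
  if s.time < T then
    { s with
      time := s.time + 1
      neighbors := List.zipWith
        (fun e m => { e with key := e.key + s.size ^ s.time * decodeNat m }) s.neighbors ms }
  else if (s.time - T) % 2 = 0 then
    { s with
      time := s.time + 1
      pivot := s.becomesPivot
      settled := s.becomesPivot || ms.any fun m => m == [true]
      neighbors := List.zipWith (fun e m => { e with pivot := m == [true] }) s.neighbors ms }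
  else
    { s with
      time := s.time + 1
      neighbors := List.zipWith (fun e m => { e with settled := m == [true] }) s.neighbors ms }

/-- The vertex joins the pivot with key `m`, according to its records. -/
def Joins (s : NodeState) (m : ℕ) : Prop :=
  s.pivot = false ∧
  ((∃ e ∈ s.neighbors, e.pivot = true ∧ e.key = m) ∧
    ∀ e ∈ s.neighbors, e.pivot = true → m ≤ e.key) ∧
  ¬ ∃ e ∈ s.neighbors, e.settled = false ∧
    ∀ e' ∈ s.neighbors, e'.pivot = true → e.key < e'.key

open Classical in
/-- The key of the centre of the cluster. -/
noncomputable def label (s : NodeState) : ℕ :=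
  if h : ∃ m, s.Joins m then h.choose else s.key

end NodeState

/-- The distributed implementation of `r`-Pivot with ranks below `n ^ c` and identifiers below `n ^
k`: keys are below `n ^ (c + k)`, and so they have `c + k` digits in base `n`. -/
noncomputable def localPivot (k c r : ℕ) : LocalAlgorithm where
  numSeeds n := if n = 0 then 1 else n ^ c
  numSeeds_pos n := by
    split_ifs with h
    · exact one_pos
    · exact pow_pos (Nat.pos_of_ne_zero h) c
  rounds _ := c + k + 2 * r
  State := NodeState
  init n ident deg seed := ⟨n, seed * n ^ k + ident, 0, false, false,
    List.replicate deg ⟨0, false, false⟩⟩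
  send s _ := s.message (c + k)
  receive s ms := s.update (c + k) ms
  output := NodeState.label

theorem decodeNat_bits (m : ℕ) : NodeState.decodeNat m.bits = m := by
  rw [NodeState.decodeNat, ← Nat.digits_two_eq_bits, Nat.ofDigits_digits]

theorem zipWith_ofFn {α β γ : Type*} {d : ℕ} (f : α → β → γ) (a : Fin d → α) (b : Fin d → β) :
    List.zipWith f (List.ofFn a) (List.ofFn b) = List.ofFn fun i => f (a i) (b i) := by
  apply List.ext_getElem <;> simp

theorem exists_mem_ofFn_iff {α : Type*} {d : ℕ} {f : Fin d → α} {p : α → Prop} :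
    (∃ e ∈ List.ofFn f, p e) ↔ ∃ i, p (f i) := by
  simp [List.mem_ofFn]

theorem forall_port_iff {V : Type*} [Fintype V] {G : SimpleGraph V} [DecidableRel G.Adj]
    (port : PortNumbering G) (v : V) {p : V → Prop} :
    (∀ i, p (port v i)) ↔ ∀ u, G.Adj v u → p u := by
  constructor
  · intro h u hu
    simpa using h ((port v).symm ⟨u, hu⟩)
  · exact fun h i => h _ (port v i).2

theorem exists_port_iff {V : Type*} [Fintype V] {G : SimpleGraph V} [DecidableRel G.Adj]
    (port : PortNumbering G) (v : V) {p : V → Prop} :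
    (∃ i, p (port v i)) ↔ ∃ u, G.Adj v u ∧ p u := by
  have := forall_port_iff port v (p := fun u => ¬ p u)
  simpa using not_congr this

variable {V : Type*} [Fintype V] (G : SimpleGraph V) [DecidableRel G.Adj] (port : PortNumbering G)
  {α : Type*} [LinearOrder α] (π : V → α) (key : V → ℕ) (T : ℕ)

open Classical in
/-- The state that the processor of `v` should have after `t` rounds, for priorities `π` encoded by
`key` and a transmission phase of `T` rounds. Pivot bits, which are sent first, are updated in the
rounds `T, T + 2, …`, and the settled bits of neighbours one round later; a vertex knows its own
settled bit as soon as it has the pivot bits of its neighbours. For `t ≤ T` the subtraction `t - T`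
truncates to `0`, as intended. -/
noncomputable def pivotNodeState (t : ℕ) (v : V) : NodeState where
  size := Fintype.card V
  key := key v
  time := t
  pivot := decide (v ∈ rPivots G π ((t - T + 1) / 2))
  settled := decide (v ∈ settledBy G (rPivots G π ((t - T + 1) / 2)))
  neighbors := List.ofFn fun i =>
    ⟨key (port v i) % Fintype.card V ^ min t T,
      decide ((port v i : V) ∈ rPivots G π ((t - T + 1) / 2)),
      decide ((port v i : V) ∈ settledBy G (rPivots G π ((t - T) / 2)))⟩

variable {G port π key T}

open Classical in
theorem becomesPivot_pivotNodeState (hkey : ∀ u v, key u < key v ↔ π u < π v)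
    (hlt : ∀ v, key v < Fintype.card V ^ T) (s : ℕ) (v : V) :
    (pivotNodeState G port π key T (T + 2 * s) v).becomesPivot =
      decide (v ∈ rPivots G π (s + 1)) := by
  have h1 : (T + 2 * s - T + 1) / 2 = s := by omega
  have h2 : (T + 2 * s - T) / 2 = s := by omega
  have h3 : min (T + 2 * s) T = T := by omega
  rw [Bool.eq_iff_iff]
  simp only [NodeState.becomesPivot, pivotNodeState, h1, h2, h3, Nat.mod_eq_of_lt (hlt _),
    Bool.or_eq_true, Bool.and_eq_true, Bool.not_eq_true', decide_eq_true_eq,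
    decide_eq_false_iff_not, List.all_eq_true, List.forall_mem_ofFn_iff, hkey]
  rw [forall_port_iff port v (p := fun u => u ∈ settledBy G (rPivots G π s) ∨ π v < π u)]
  simp only [rPivots, Set.mem_union, Set.mem_ofPred_eq, or_iff_not_imp_left]

theorem update_pivotNodeState (hkey : ∀ u v, key u < key v ↔ π u < π v)
    (hlt : ∀ v, key v < Fintype.card V ^ T) (t : ℕ) (v : V) :
    (pivotNodeState G port π key T t v).update T
        (List.ofFn fun i => (pivotNodeState G port π key T t (port v i)).message T) =
      pivotNodeState G port π key T (t + 1) v := by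
  classical
  rcases Nat.lt_or_ge t T with h | h
  · have e1 : t + 1 - T = t - T := by omega
    have e2 : min t T = t := by omega
    have e3 : min (t + 1) T = t + 1 := by omega
    have ht : ∀ v, (pivotNodeState G port π key T t v).time < T := fun _ => h
    rw [NodeState.update, if_pos (ht v)]
    simp only [NodeState.message, if_pos (ht _)]
    simp only [pivotNodeState, zipWith_ofFn, decodeNat_bits, e1, e2, e3, Nat.mod_pow_succ]
  · obtain ⟨s, rfl | rfl⟩ : ∃ s, t = T + 2 * s ∨ t = T + 2 * s + 1 :=
      ⟨(t - T) / 2, by omega⟩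
    · have ht : ∀ v, ¬ (pivotNodeState G port π key T (T + 2 * s) v).time < T := fun _ => by
        simp [pivotNodeState]
      have hp : ∀ v, ((pivotNodeState G port π key T (T + 2 * s) v).time - T) % 2 = 0 :=
        fun _ => by simp [pivotNodeState]
      rw [NodeState.update, if_neg (ht v), if_pos (hp v)]
      simp only [NodeState.message, if_neg (ht _), if_pos (hp _),
        becomesPivot_pivotNodeState hkey hlt]
      have e1 : (T + 2 * s + 1 - T + 1) / 2 = s + 1 := by omega
      have e2 : (T + 2 * s + 1 - T) / 2 = s := by omega
      have e3 : (T + 2 * s - T) / 2 = s := by omega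
      have e4 : min (T + 2 * s + 1) T = min (T + 2 * s) T := by omega
      simp only [pivotNodeState, zipWith_ofFn, e1, e2, e3, e4]
      congr 1
      · rw [Bool.eq_iff_iff]
        simp only [Bool.or_eq_true, decide_eq_true_eq, List.any_eq_true, exists_mem_ofFn_iff,
          beq_iff_eq, List.cons.injEq, and_true]
        rw [exists_port_iff port v (p := fun u => u ∈ rPivots G π (s + 1))]
        simp only [settledBy, Set.mem_ofPred_eq, G.adj_comm v, and_comm]
      · simp
    · have ht : ∀ v, ¬ (pivotNodeState G port π key T (T + 2 * s + 1) v).time < T := fun _ => by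
        simp only [pivotNodeState]; omega
      have hp : ∀ v, ¬ ((pivotNodeState G port π key T (T + 2 * s + 1) v).time - T) % 2 = 0 :=
        fun _ => by simp only [pivotNodeState]; omega
      rw [NodeState.update, if_neg (ht v), if_neg (hp v)]
      simp only [NodeState.message, if_neg (ht _), if_neg (hp _)]
      have e1 : (T + 2 * s + 1 - T + 1) / 2 = s + 1 := by omega
      have e2 : (T + 2 * s + 1 + 1 - T) / 2 = s + 1 := by omega
      have e3 : (T + 2 * s + 1 + 1 - T + 1) / 2 = s + 1 := by omega
      have e4 : min (T + 2 * s + 1 + 1) T = min (T + 2 * s + 1) T := by omega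
      simp only [pivotNodeState, zipWith_ofFn, e1, e2, e3, e4]
      congr 1
      simp

theorem label_pivotNodeState (hkey : ∀ u v, key u < key v ↔ π u < π v)
    (hinj : Function.Injective key)
    (hlt : ∀ v, key v < Fintype.card V ^ T) (r : ℕ) (v : V) :
    (pivotNodeState G port π key T (T + 2 * r) v).label = key (rPivotCenter G π r v) := by
  classical
  have hπ : Function.Injective π := fun u v h => by
    by_contra hne
    rcases lt_or_gt_of_ne (hinj.ne hne) with h' | h'
    · exact absurd h ((hkey _ _).1 h').ne
    · exact absurd h ((hkey _ _).1 h').ne'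
  have hle : ∀ u v, key u ≤ key v ↔ π u ≤ π v := fun u v => by
    rw [← not_lt, hkey, not_lt]
  have h1 : (T + 2 * r - T + 1) / 2 = r := by omega
  have h2 : (T + 2 * r - T) / 2 = r := by omega
  have h3 : min (T + 2 * r) T = T := by omega
  have hjoins : ∀ m, (pivotNodeState G port π key T (T + 2 * r) v).Joins m ↔
      ∃ p, key p = m ∧ JoinsPivot G π r v p := by
    intro m
    simp only [NodeState.Joins, pivotNodeState, h1, h2, h3, Nat.mod_eq_of_lt (hlt _),
      List.forall_mem_ofFn_iff, exists_mem_ofFn_iff, decide_eq_true_eq,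
      decide_eq_false_iff_not, hkey]
    simp only [forall_port_iff port v (p := fun u => u ∈ rPivots G π r → m ≤ key u),
      exists_port_iff port v (p := fun u => u ∈ rPivots G π r ∧ key u = m)]
    have h4 : ∀ w, (∀ i, (port v i : V) ∈ rPivots G π r → π w < π (port v i)) ↔
        ∀ q ∈ rPivots G π r, G.Adj v q → π w < π q := fun w => by
      rw [forall_port_iff port v (p := fun u => u ∈ rPivots G π r → π w < π u)]
      tauto
    simp only [h4]
    rw [exists_port_iff port v (p := fun w => w ∉ settledBy G (rPivots G π r) ∧
      ∀ q ∈ rPivots G π r, G.Adj v q → π w < π q)]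
    constructor
    · rintro ⟨a, ⟨⟨p, hp1, hp2, rfl⟩, b⟩, d⟩
      exact ⟨p, rfl, a, ⟨hp2, hp1, fun q hq hvq => (hle _ _).1 (b q hvq hq)⟩, d⟩
    · rintro ⟨p, rfl, a, ⟨hp2, hp1, b⟩, d⟩
      exact ⟨a, ⟨⟨p, hp1, hp2, rfl⟩, fun q hvq hq => (hle _ _).2 (b q hq hvq)⟩, d⟩
  rw [NodeState.label]
  split_ifs with h
  · obtain ⟨p, hp, hjp⟩ := (hjoins _).1 h.choose_spec
    rw [← hp, rPivotCenter_eq_of_joinsPivot hπ hjp]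
  · rw [rPivotCenter, dif_neg]
    · rfl
    · rintro ⟨p, hp⟩
      exact h ⟨key p, (hjoins _).2 ⟨p, rfl, hp⟩⟩

theorem length_message_le {s : NodeState} (hs : 2 ≤ s.size) :
    ((s.message T).length : ℝ) ≤ 2 * Real.logb 2 s.size := by
  have h1 : 1 ≤ Nat.log 2 s.size := Nat.log_pos (by norm_num) hs
  have h2 : (Nat.log 2 s.size : ℝ) ≤ Real.logb 2 s.size := by
    exact_mod_cast Real.natLog_le_logb s.size 2
  have h3 : (s.message T).length ≤ 2 * Nat.log 2 s.size := by
    rw [NodeState.message]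
    split_ifs
    · rw [Nat.size_eq_bits_len]
      have : (s.key / s.size ^ s.time % s.size).size ≤ Nat.log 2 s.size + 1 := by
        rw [Nat.size_le]
        exact (Nat.mod_lt _ (by omega)).trans (Nat.lt_pow_succ_log_self (by norm_num) _)
      omega
    · simp only [List.length_singleton]; omega
    · simp only [List.length_singleton]; omega
  calc ((s.message T).length : ℝ) ≤ ((2 * Nat.log 2 s.size : ℕ) : ℝ) := by exact_mod_cast h3
    _ = 2 * (Nat.log 2 s.size : ℝ) := by push_cast; ring
    _ ≤ _ := by gcongr

/-- Rank and identifier, encoded as an integer. -/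
def rankKey (k : ℕ) {N : ℕ} (ident : V → ℕ) (ω : V → Fin N) (v : V) : ℕ :=
  ω v * Fintype.card V ^ k + ident v

theorem rankKey_lt_iff {k N : ℕ} {ident : V → ℕ} (hid : ∀ v, ident v < Fintype.card V ^ k)
    (ω : V → Fin N) (u v : V) :
    rankKey k ident ω u < rankKey k ident ω v ↔
      rankPriority ident ω u < rankPriority ident ω v := by
  have hu := hid u
  have hv := hid v
  simp only [rankKey, rankPriority, Prod.Lex.toLex_lt_toLex]
  rcases lt_trichotomy (ω u : ℕ) (ω v) with h | h | h
  · have := Nat.mul_le_mul_right (Fintype.card V ^ k) (Nat.succ_le_of_lt h)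
    rw [Nat.succ_mul] at this
    exact iff_of_true (by omega) (Or.inl h)
  · simp [h]
  · have := Nat.mul_le_mul_right (Fintype.card V ^ k) (Nat.succ_le_of_lt h)
    rw [Nat.succ_mul] at this
    exact iff_of_false (by omega) (by omega)

end LocalPivot

section Correctness

variable {V : Type*} [Fintype V] {G : SimpleGraph V} [DecidableRel G.Adj] {k c r : ℕ}
  {ident : V → ℕ}

theorem rankKey_lt (hid : ∀ v, ident v < Fintype.card V ^ k) (ω : (localPivot k c r).Seeds V)
    (v : V) : rankKey k ident ω v < Fintype.card V ^ (c + k) := by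
  have hpos : Fintype.card V ≠ 0 := (Fintype.card_pos_iff.2 ⟨v⟩).ne'
  have h1 : (ω v : ℕ) < Fintype.card V ^ c := by
    have := (ω v).2
    simpa only [localPivot, if_neg hpos] using this
  have h2 := Nat.mul_le_mul_right (Fintype.card V ^ k) (Nat.succ_le_of_lt h1)
  rw [Nat.succ_mul, ← pow_add] at h2
  have := hid v
  rw [rankKey]
  omega

theorem rankKey_injective (hid : ∀ v, ident v < Fintype.card V ^ k)
    (hinj : Function.Injective ident) {N : ℕ} (ω : V → Fin N) :
    Function.Injective (rankKey k ident ω) := by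
  intro u v h
  have h1 := (rankKey_lt_iff hid ω u v).not.1 h.not_lt
  have h2 := (rankKey_lt_iff hid ω v u).not.1 h.symm.not_lt
  have h3 := le_antisymm (not_lt.1 h2) (not_lt.1 h1)
  exact hinj (Prod.ext_iff.1 (toLex.injective h3)).2

theorem stateAt_localPivot (hid : ∀ v, ident v < Fintype.card V ^ k) (port : PortNumbering G)
    (ω : (localPivot k c r).Seeds V) : ∀ (t : ℕ),
    (localPivot k c r).stateAt G ident port ω t = pivotNodeState G port (rankPriority ident ω)
      (rankKey k ident ω) (c + k) t
  | 0 => by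
    classical
    funext v
    simp [LocalAlgorithm.stateAt, pivotNodeState, localPivot, rankKey, rPivots, settledBy,
      Nat.mod_one]
  | t + 1 => by
    funext v
    rw [LocalAlgorithm.stateAt]
    simp only [LocalAlgorithm.incoming]
    rw [stateAt_localPivot hid port ω t]
    exact update_pivotNodeState (rankKey_lt_iff hid ω) (rankKey_lt hid ω) t v

theorem clustering_localPivot (hid : ∀ v, ident v < Fintype.card V ^ k)
    (hinj : Function.Injective ident) (port : PortNumbering G)
    (ω : (localPivot k c r).Seeds V) :
    (localPivot k c r).clustering G ident port ω =
      rPivotClustering G (rankPriority ident ω) r := by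
  have hlabel : ∀ v, (localPivot k c r).output ((localPivot k c r).stateAt G ident port ω
      ((localPivot k c r).rounds (Fintype.card V)) v) =
        rankKey k ident ω (rPivotCenter G (rankPriority ident ω) r v) := fun v => by
    rw [stateAt_localPivot hid port ω]
    exact label_pivotNodeState (rankKey_lt_iff hid ω) (rankKey_injective hid hinj ω)
      (rankKey_lt hid ω) r v
  ext u v
  rw [LocalAlgorithm.clustering, rPivotClustering, Setoid.ker_def, Setoid.ker_def, hlabel, hlabel,
    (rankKey_injective hid hinj ω).eq_iff]

theorem messagesBounded_localPivot (hid : ∀ v, ident v < Fintype.card V ^ k)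
    (port : PortNumbering G) :
    (localPivot k c r).MessagesBounded G ident port (2 * Real.logb 2 (Fintype.card V)) := by
  classical
  intro ω t _ v i
  rw [LocalAlgorithm.incoming, stateAt_localPivot hid port ω]
  refine length_message_le (T := c + k) (s := pivotNodeState G port (rankPriority ident ω)
    (rankKey k ident ω) (c + k) t (port v i)) ?_
  exact Fintype.one_lt_card_iff.2 ⟨v, port v i, (port v i).2.ne⟩

theorem expectedCost_localPivot_le [DecidableEq V] (hid : ∀ v, ident v < Fintype.card V ^ k)
    (hinj : Function.Injective ident) (port : PortNumbering G) (hr : 0 < r) {δ : ℝ} (hδ0 : 0 ≤ δ)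
    (hδ : 2 ≤ Fintype.card V → (Fintype.card V : ℝ) ^ 4 ≤ δ * (Fintype.card V : ℝ) ^ c) :
    (localPivot k c r).expectedCost G ident port ≤ (3 + 9 / r + δ) * optCost G := by
  have hN := (localPivot k c r).numSeeds_pos (Fintype.card V)
  rw [LocalAlgorithm.expectedCost]
  simp only [clustering_localPivot hid hinj port]
  rw [div_le_iff₀ (by
    rw [Fintype.card_fun, Fintype.card_fin]
    exact_mod_cast pow_pos hN _)]
  refine (sum_cost_le G hinj hr (fun h => ?_) hN hδ0).trans (le_of_eq ?_)
  · have hne : Fintype.card V ≠ 0 := by omega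
    have := hδ h
    simpa only [localPivot, if_neg hne, Nat.cast_pow] using this
  · rw [Fintype.card_fun, Fintype.card_fin, Nat.cast_pow, mul_comm]

end Correctness

/-- The rank exponent `M + 5` makes ties so rare that they cost less than `1 / (2 * M)` times the
optimum. -/
theorem pow_four_le {M n : ℕ} (hM : 0 < M) (hn : 2 ≤ n) :
    (n : ℝ) ^ 4 ≤ 1 / (2 * M) * (n : ℝ) ^ (M + 5) := by
  have h1 : 2 * M ≤ n ^ (M + 1) :=
    calc 2 * M ≤ 2 * 2 ^ M := by gcongr; exact Nat.lt_two_pow_self.le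
      _ = 2 ^ (M + 1) := by ring
      _ ≤ n ^ (M + 1) := Nat.pow_le_pow_left hn _
  have h2 : (2 * M : ℝ) ≤ (n : ℝ) ^ (M + 1) := by exact_mod_cast h1
  have hM' : (0 : ℝ) < M := by exact_mod_cast hM
  rw [one_div, ← div_eq_inv_mul, le_div_iff₀ (by positivity)]
  calc (n : ℝ) ^ 4 * (2 * M) ≤ (n : ℝ) ^ 4 * (n : ℝ) ^ (M + 1) := by gcongr
    _ = _ := by ring

theorem corollary5 (k : ℕ) :
    ∃ C : ℕ, ∀ ε : ℝ, 0 < ε → ∃ (A : LocalAlgorithm) (r c : ℕ),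
      1 ≤ r ∧ r ≤ C * ⌈1 / ε⌉₊ ∧
      (∀ n : ℕ, 0 < n → A.numSeeds n = n ^ c) ∧
      (∀ n : ℕ, A.rounds n ≤ C * ⌈1 / ε⌉₊) ∧
      ∀ (V : Type*) [Fintype V] [DecidableEq V] (G : SimpleGraph V) [DecidableRel G.Adj]
        (ident : V → ℕ) (_ : Function.Injective ident)
        (_ : ∀ v, ident v < Fintype.card V ^ k) (port : PortNumbering G),
        A.MessagesBounded G ident port (C * Real.logb 2 (Fintype.card V)) ∧
        (∀ ω : A.Seeds V, A.clustering G ident port ω =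
          rPivotClustering G (fun v => toLex ((ω v : ℕ), ident v)) r) ∧
        A.expectedCost G ident port ≤ (3 + ε) * optCost G := by
  -- the `c + k + 2 * r = 37 * M + 5 + k` rounds are at most `(k + 42) * M`
  refine ⟨k + 42, fun ε hε => ?_⟩
  set M := ⌈1 / ε⌉₊
  have hM : 0 < M := Nat.ceil_pos.2 (by positivity)
  have hMε : 1 / ε ≤ M := Nat.le_ceil _
  have hM' : (0 : ℝ) < M := by exact_mod_cast hM
  have hkM : k ≤ k * M := Nat.le_mul_of_pos_right k hM
  refine ⟨localPivot k (M + 5) (18 * M), 18 * M, M + 5, by omega, by nlinarith,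
    fun n hn => if_neg hn.ne', fun n => ?_, ?_⟩
  · change M + 5 + k + 2 * (18 * M) ≤ (k + 42) * M
    rw [add_mul]
    omega
  intro V _ _ G _ ident hinj hid port
  refine ⟨?_, clustering_localPivot hid hinj port, ?_⟩
  · intro ω t ht v i
    refine (messagesBounded_localPivot hid port ω t ht v i).trans ?_
    have hn : (1 : ℝ) ≤ Fintype.card V := by
      exact_mod_cast Fintype.card_pos_iff.2 ⟨v⟩
    have := Real.logb_nonneg one_lt_two hn
    gcongr
    push_cast
    linarith [(Nat.cast_nonneg k : (0 : ℝ) ≤ k)]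
  · refine (expectedCost_localPivot_le hid hinj port (by omega) (δ := 1 / (2 * M))
      (by positivity) fun h => pow_four_le hM h).trans ?_
    refine mul_le_mul_of_nonneg_right ?_ (Nat.cast_nonneg _)
    have h1 : 1 / (M : ℝ) ≤ ε := by
      rw [div_le_iff₀ hM']
      rwa [div_le_iff₀' hε] at hMε
    have h2 : 3 + 9 / ((18 * M : ℕ) : ℝ) + 1 / (2 * M) = 3 + 1 / (M : ℝ) := by
      push_cast
      field_simp
      ring
    rw [h2]
    linarith
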